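/- \textbf{Asynchronous incremental voting on random graphs.} In asynchronous incremental voting on a finite graph $G=(V,E)$ with $n$ vertices, every vertex $v$ holds an integer opinion $X_v(t)$ at step $t$. In each step a pair $(v,w)$ of adjacent vertices is selected, independently of the past: in the \emph{vertex process} $v$ is a uniformly random vertex and $w$ a uniformly random neighbour of $v$; in the \emph{edge process} $v$ is a uniformly random endpoint of a uniformly random edge and $w$ is the other endpoint. Then $X_v$ is replaced by $X_v+1$ if $X_v<X_w$ and by $X_v-1$ if $X_v>X_w$; all other opinions stay as they are. (If there is no such pair to select, nothing changes.) Opinion $i$ \emph{wins} if at some step all vertices hold opinion $i$; the process \emph{finishes} at the first step at which all opinions are equal. Fix an integer $k\ge 1$ and a constant $\varepsilon>0$. Let $G\in G_{n,p}$ be the binomial random graph on $n$ vertices, where $p=p(n)\in[0,1]$ satisfies $np\ge(\log n)^{1+\varepsilon}$. The following holds for both processes, with probability $1-o(1)$ over $G$ as $n\to\infty$, for all initial opinions $X_v(0)\in\{1,\dots,k\}$ simultaneously; here $c=\frac1n\sum_{v}X_v(0)$, and $\mathbb P$ and the expectation refer to the random selections of the voting process on the given graph $G$. (i) Let $i$ be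 an integer with $i<c<i+1$. Then $\mathbb{P}(i\text{ wins})=(1+o(1))(i+1-c)$ as long as $i+1-c$ is bounded away from $0$, and $\mathbb{P}(i+1\text{ wins})=(1+o(1))(c-i)$ as long as $c-i$ is bounded away from $0$. If $c=i(1+o(1))$ for an integer $i$, then $\mathbb{P}(i\text{ wins})=1-o(1)$. All $o(1)$ terms are uniform in the initial opinions and in $p$. (ii) The expected time for the process to finish is at most $Cn^2$, where $C$ depends only on $k$ and $\varepsilon$. -/

import Mathlib

open MeasureTheory ProbabilityTheory

namespace IncrementalVoting

/-- The two asynchronous processes: in the vertex process a uniformly random vertex observes a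
uniformly random neighbour; in the edge process a uniformly random endpoint of a uniformly random
edge observes the other endpoint. -/
inductive Scheme
  | vertex
  | edge

open Classical in
/-- The law of the selected pair `(v, w)` in one step of the given process: `v` is the vertex that
is updated and `w` is the vertex that it observes. A uniformly random endpoint of a uniformly random
edge is the same as a uniformly random ordered pair of adjacent vertices.
If there is nothing to choose from (an isolated vertex was picked, respectively the graph has no
edge), a vertex observes itself, and so nothing changes in this step. -/
noncomputable def selection (s : Scheme) {n : ℕ} [NeZero n] (G : SimpleGraph (Fin n)) :
    PMF (Fin n × Fin n) :=
  match s with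
  | .vertex =>
      (PMF.uniformOfFintype (Fin n)).bind fun v =>
        if h : (Finset.univ.filter fun w => G.Adj v w).Nonempty then
          (PMF.uniformOfFinset (Finset.univ.filter fun w => G.Adj v w) h).map fun w => (v, w)
        else PMF.pure (v, v)
  | .edge =>
      if h : (Finset.univ.filter fun e : Fin n × Fin n => G.Adj e.1 e.2).Nonempty then
        PMF.uniformOfFinset (Finset.univ.filter fun e : Fin n × Fin n => G.Adj e.1 e.2) h
      else PMF.pure (0, 0)

/-- The new opinion of a vertex with opinion `x` that observes opinion `y`. -/
def newOpinion (x y : ℤ) : ℤ :=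
  if x < y then x + 1 else if x = y then x else x - 1

/-- The opinions after a step in which the pair `e = (v, w)` is selected. -/
def step {n : ℕ} (X : Fin n → ℤ) (e : Fin n × Fin n) : Fin n → ℤ :=
  Function.update X e.1 (newOpinion (X e.1) (X e.2))

/-- The opinions `X(t)` at step `t`, where `X₀` are the initial opinions and `sel j` is the pair
selected at step `j`. -/
def opinions {n : ℕ} (X₀ : Fin n → ℤ) (sel : ℕ → Fin n × Fin n) : ℕ → Fin n → ℤ
  | 0 => X₀
  | t + 1 => step (opinions X₀ sel t) (sel t)

/-- The probability space of the process: the pairs selected at the steps `0, 1, 2, …` are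
independent with law `selection s G`. -/
noncomputable def processLaw (s : Scheme) {n : ℕ} [NeZero n] (G : SimpleGraph (Fin n)) :
    Measure (ℕ → Fin n × Fin n) :=
  Measure.infinitePi fun _ : ℕ => (selection s G).toMeasure

/-- The probability that opinion `i` wins: at some step all vertices have opinion `i`
(and then they keep it for ever). -/
noncomputable def winProb (s : Scheme) {n : ℕ} [NeZero n] (G : SimpleGraph (Fin n))
    (X₀ : Fin n → ℤ) (i : ℤ) : ℝ :=
  (processLaw s G).real {sel | ∃ t, ∀ v, opinions X₀ sel t v = i}

/-- The time at which the process finishes: the first step at which all vertices have the same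
opinion (`∞` if there is none). -/
noncomputable def finishTime {n : ℕ} (X₀ : Fin n → ℤ) (sel : ℕ → Fin n × Fin n) : ENNReal :=
  ⨅ (t : ℕ) (_ : ∃ i : ℤ, ∀ v, opinions X₀ sel t v = i), (t : ENNReal)

/-- The expected time for the process to finish. -/
noncomputable def expectedTime (s : Scheme) {n : ℕ} [NeZero n] (G : SimpleGraph (Fin n))
    (X₀ : Fin n → ℤ) : ENNReal :=
  ∫⁻ sel, finishTime X₀ sel ∂(processLaw s G)

/-- The average `c = S(0) / n` of the opinions. -/
noncomputable def average {n : ℕ} (X : Fin n → ℤ) : ℝ :=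
  (∑ v, (X v : ℝ)) / n

/-- The property `A` holds w.h.p. for the random graph `G(n, p)` with `n p ≥ (log n) ^ (1 + ε)`:
its probability tends to one as `n → ∞` (uniformly over all such `p`, which is the same as along
every sequence `p = p(n)` of this kind). -/
def Whp (ε : ℝ) (A : ∀ n : ℕ, [NeZero n] → SimpleGraph (Fin n) → Prop) : Prop :=
  ∀ τ : ℝ, 0 < τ → ∃ N : ℕ, ∀ (n : ℕ) [NeZero n], N ≤ n → ∀ p : unitInterval,
    Real.log n ^ (1 + ε) ≤ n * (p : ℝ) →
      1 - τ ≤ (SimpleGraph.binomialRandom (Fin n) p).real {G | A n G}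

end IncrementalVoting

/-!
One step of voting changes the configuration by a Markov kernel, `stepExp`. For suitable vertex
weights `w` (uniform in the edge process, proportional to the degrees in the vertex process) the
selection satisfies detailed balance, so that the weighted average `∑ v, w v * X v` is a martingale
with increments `O(1 / n)`.

The engine of the proof is a Lyapunov function, `potential`. If `a` and `b` are the weights of the
sets of vertices with the smallest and with the largest opinion, it is
`√a + √b + (largest opinion - smallest opinion)`; the last term makes up for the jump of the square
root when an extreme opinion disappears. The weight `a` is a supermartingale: it exchanges mass with
the next opinion in a balanced way, and loses mass to all opinions that are at least two larger.
Since the square root is concave, the fluctuations of `a` give `√a` a drift of order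
`-1 / (√a n ^ 2)`, by the edge expansion of the graph. Hence

* without consensus the potential has drift at most `-const / n ^ 2`
  (`stepExp_potential_le_of_not_consensus`), which gives the bound on the expected time
  (`expectedTime_le`);
* if the extreme opinions differ by at least two, the drift is at most `-L / n ^ 2` for any given
  constant `L` (`stepExp_potential_le_of_spread`): if `a` or `b` is small, because of the factor
  `1 / √a` above, and if both are at least a constant, because of the loss of mass, which is then of
  order `1 / n`.

So only two consecutive opinions are left after `o(n ^ 2)` steps, in which the weighted average
moves by `o(1)`, and from then on the winning probabilities are affine in the weighted average by
optional stopping. No stopping times appear in the formal proof: both parts of this argument are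
applications of a maximum principle for superharmonic functions (`nonneg_of_superharmonic`). The
outcome is that the probability that `i` wins is within `o(1)` of the piecewise linear function
`tent i`, evaluated at the average (`abs_winProb_sub_tent_le`).

The graph enters only through `IsTypical`: almost equal degrees, edge expansion, and many edges
between any two disjoint sets of linear size. For the binomial random graph this follows from
Chernoff's bound and union bounds (`whp_isTypical`).
-/

namespace IncrementalVoting

section

/-! ### The Markov property -/

/-- The selection sequence that starts with `e` and continues with `ω`. -/
def consSel {α : Type*} (e : α) (ω : ℕ → α) : ℕ → α
  | 0 => e
  | t + 1 => ω t

lemma measurable_consSel {α : Type*} [MeasurableSpace α] :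
    Measurable fun x : α × (ℕ → α) => consSel x.1 x.2 := by
  refine measurable_pi_lambda _ fun t => ?_
  cases t with
  | zero => exact measurable_fst
  | succ t => exact (measurable_pi_apply t).comp measurable_snd

/-- An i.i.d. sequence is an independent first term followed by an i.i.d. sequence. -/
lemma map_consSel_prod {α : Type*} [MeasurableSpace α] (μ : Measure α) [IsProbabilityMeasure μ] :
    (μ.prod (Measure.infinitePi fun _ : ℕ => μ)).map (fun x => consSel x.1 x.2) =
      Measure.infinitePi fun _ : ℕ => μ := by
  classical
  refine Measure.eq_infinitePi _ fun s t ht => ?_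
  have hinj : Set.InjOn Nat.succ (Nat.succ ⁻¹' (s : Set ℕ)) := Nat.succ_injective.injOn
  have hpre : (fun x : α × (ℕ → α) => consSel x.1 x.2) ⁻¹' (Set.pi s t) =
      (if 0 ∈ s then t 0 else Set.univ) ×ˢ
        Set.pi (s.preimage Nat.succ hinj) (fun j => t (j + 1)) := by
    ext ⟨e, ω⟩
    simp only [Set.mem_preimage, Set.mem_pi, Set.mem_prod, Finset.mem_coe, Finset.mem_preimage]
    constructor
    · intro h
      refine ⟨?_, fun j hj => h (j + 1) hj⟩
      split_ifs with h0
      · exact h 0 h0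
      · trivial
    · rintro ⟨h0, h1⟩ i hi
      cases i with
      | zero => rw [if_pos hi] at h0; exact h0
      | succ j => exact h1 j hi
  rw [Measure.map_apply measurable_consSel (MeasurableSet.pi s.countable_toSet fun i _ => ht i),
    hpre, Measure.prod_prod, Measure.infinitePi_pi _ fun i _ => ht (i + 1)]
  rw [Finset.prod_filter_mul_prod_filter_not s (fun i => i = 0) (fun i => μ (t i)) |>.symm]
  congr 1
  · by_cases h0 : 0 ∈ s
    · have : s.filter (fun i => i = 0) = {0} := by ext i; simp; grind
      rw [this, if_pos h0]; simp
    · have : s.filter (fun i => i = 0) = ∅ := by ext i; simp; grind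
      rw [this, if_neg h0]; simp
  · have : s.filter (fun i => ¬ i = 0) = (s.preimage Nat.succ hinj).image Nat.succ := by
      ext i
      cases i <;> simp
    rw [this, Finset.prod_image Nat.succ_injective.injOn]

variable {n : ℕ}

lemma opinions_consSel (X : Fin n → ℤ) (e : Fin n × Fin n) (ω : ℕ → Fin n × Fin n) (t : ℕ) :
    opinions X (consSel e ω) (t + 1) = opinions (step X e) ω t := by
  induction t with
  | zero => rfl
  | succ t ih => rw [opinions, ih]; rfl

lemma measurable_opinions (X : Fin n → ℤ) (t : ℕ) :
    Measurable fun sel : ℕ → Fin n × Fin n => opinions X sel t := by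
  induction t with
  | zero => exact measurable_const
  | succ t ih =>
    have : Measurable fun x : (Fin n → ℤ) × (Fin n × Fin n) => step x.1 x.2 := Measurable.of_discrete
    exact this.comp (ih.prodMk (measurable_pi_apply t))

lemma measurableSet_opinions (X : Fin n → ℤ) (t : ℕ) (p : (Fin n → ℤ) → Prop) :
    MeasurableSet {sel : ℕ → Fin n × Fin n | p (opinions X sel t)} :=
  measurable_opinions X t (MeasurableSet.of_discrete (s := {Y | p Y}))

lemma step_consensus {X : Fin n → ℤ} {i : ℤ} (h : ∀ v, X v = i) (e : Fin n × Fin n) :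
    step X e = X := by
  simp [step, newOpinion, h]

lemma opinions_consensus {X : Fin n → ℤ} {i : ℤ} (h : ∀ v, X v = i)
    (sel : ℕ → Fin n × Fin n) (t : ℕ) : opinions X sel t = X := by
  induction t with
  | zero => rfl
  | succ t ih => rw [opinions, ih, step_consensus h]

lemma exists_opinions_consSel (X : Fin n → ℤ) (i : ℤ) (e : Fin n × Fin n)
    (ω : ℕ → Fin n × Fin n) :
    (∃ t, ∀ v, opinions X (consSel e ω) t v = i) ↔ ∃ t, ∀ v, opinions (step X e) ω t v = i := by
  constructor
  · rintro ⟨t, ht⟩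
    cases t with
    | zero => exact ⟨0, fun v => by rw [opinions, step_consensus (X := X) ht]; exact ht v⟩
    | succ t => exact ⟨t, by rwa [opinions_consSel] at ht⟩
  · rintro ⟨t, ht⟩
    exact ⟨t + 1, by rwa [opinions_consSel]⟩

lemma finishTime_consensus {X : Fin n → ℤ} {i : ℤ} (h : ∀ v, X v = i)
    (sel : ℕ → Fin n × Fin n) : finishTime X sel = 0 := by
  refine le_antisymm (iInf₂_le_of_le 0 ⟨i, h⟩ ?_) bot_le
  simp

lemma finishTime_consSel_le (X : Fin n → ℤ) (e : Fin n × Fin n) (ω : ℕ → Fin n × Fin n) :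
    finishTime X (consSel e ω) ≤ finishTime (step X e) ω + 1 := by
  rw [finishTime, finishTime, ENNReal.iInf_add]
  refine le_iInf fun t => ?_
  by_cases h : ∃ i : ℤ, ∀ v, opinions (step X e) ω t v = i
  · rw [iInf_pos h]
    refine iInf₂_le_of_le (t + 1) (by rwa [opinions_consSel]) ?_
    push_cast; rfl
  · rw [iInf_neg h]; simp

lemma measurable_finishTime (X : Fin n → ℤ) :
    Measurable fun sel : ℕ → Fin n × Fin n => finishTime X sel := by
  classical
  unfold finishTime
  refine Measurable.iInf fun t => ?_
  have : (fun sel : ℕ → Fin n × Fin n =>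
      ⨅ (_ : ∃ i : ℤ, ∀ v, opinions X sel t v = i), (t : ENNReal)) =
      fun sel => if ∃ i : ℤ, ∀ v, opinions X sel t v = i then (t : ENNReal) else ⊤ := by
    ext sel
    split_ifs with h
    · rw [iInf_pos h]
    · rw [iInf_neg h]
  rw [this]
  exact Measurable.ite (measurableSet_opinions X t fun Z => ∃ i : ℤ, ∀ v, Z v = i)
    measurable_const measurable_const

variable [NeZero n] (s : Scheme) (G : SimpleGraph (Fin n))

instance : IsProbabilityMeasure (processLaw s G) := by
  unfold processLaw; infer_instance

lemma lintegral_processLaw {f : (ℕ → Fin n × Fin n) → ENNReal} (hf : Measurable f) :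
    ∫⁻ ω, f ω ∂processLaw s G =
      ∑ e, selection s G e * ∫⁻ ω, f (consSel e ω) ∂processLaw s G := by
  conv_lhs => rw [processLaw, ← map_consSel_prod]
  rw [lintegral_map hf measurable_consSel,
    lintegral_prod (fun x => f (consSel x.1 x.2)) (hf.comp measurable_consSel).aemeasurable,
    lintegral_fintype]
  refine Finset.sum_congr rfl fun e _ => ?_
  rw [PMF.toMeasure_apply_singleton _ _ (measurableSet_singleton e), mul_comm]
  rfl

/-- The expectation of `f` after one step that starts from the opinions `X`. -/
noncomputable def stepExp (f : (Fin n → ℤ) → ℝ) (X : Fin n → ℤ) : ℝ :=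
  ∑ e, (selection s G e).toReal * f (step X e)

lemma sum_selection : ∑ e, (selection s G e).toReal = 1 := by
  have h := (selection s G).tsum_coe
  rw [tsum_fintype] at h
  rw [← ENNReal.toReal_sum fun e _ => PMF.apply_ne_top _ _, h, ENNReal.toReal_one]

lemma winProb_consensus {X : Fin n → ℤ} {j : ℤ} (h : ∀ v, X v = j) (i : ℤ) :
    winProb s G X i = if j = i then 1 else 0 := by
  unfold winProb
  simp only [opinions_consensus h, h]
  split_ifs with hj <;> simp [hj]

/-- The probability that `i` wins is a harmonic function of the opinions. -/
lemma stepExp_winProb (X : Fin n → ℤ) (i : ℤ) :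
    stepExp s G (fun Y => winProb s G Y i) X = winProb s G X i := by
  have hm : ∀ Y : Fin n → ℤ,
      MeasurableSet {sel : ℕ → Fin n × Fin n | ∃ t, ∀ v, opinions Y sel t v = i} := fun Y => by
    rw [Set.ofPred_exists]
    exact MeasurableSet.iUnion fun t => measurableSet_opinions Y t (fun Z => ∀ v, Z v = i)
  have h := lintegral_processLaw s G (measurable_one.indicator (hm X))
  rw [lintegral_indicator_one (hm X)] at h
  unfold stepExp winProb
  rw [measureReal_def, h, ENNReal.toReal_sum fun e _ => ENNReal.mul_ne_top (PMF.apply_ne_top _ _) ?_]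
  · refine Finset.sum_congr rfl fun e _ => ?_
    beta_reduce
    rw [ENNReal.toReal_mul, measureReal_def, ← lintegral_indicator_one (hm _)]
    congr 2
    refine lintegral_congr fun ω => ?_
    classical
    simp only [Set.indicator_apply]
    exact if_congr (exists_opinions_consSel X i e ω).symm rfl rfl
  · refine ne_top_of_le_ne_top (b := 1) ENNReal.one_ne_top ?_
    calc _ ≤ ∫⁻ _, 1 ∂processLaw s G := 
          lintegral_mono fun ω => Set.indicator_le_self' (f := fun _ => 1) (by simp) _
      _ = 1 := by simp

/-- A Lyapunov function that decreases by at least `κ` per step in expectation, as long as there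
is no consensus, bounds the expected time to finish. The set `S` is closed under steps. -/
lemma expectedTime_le {S : Set (Fin n → ℤ)} (hS : ∀ X ∈ S, ∀ e, step X e ∈ S)
    {Ψ : (Fin n → ℤ) → ℝ} (hΨ : ∀ X ∈ S, 0 ≤ Ψ X) {κ : ℝ} (hκ : 0 < κ)
    (hdrift : ∀ X ∈ S, (¬ ∃ i : ℤ, ∀ v, X v = i) → stepExp s G Ψ X ≤ Ψ X - κ)
    {X : Fin n → ℤ} (hX : X ∈ S) : expectedTime s G X ≤ ENNReal.ofReal (Ψ X / κ) := by
  -- truncated times are finite, which makes an induction over the truncation possible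
  have key : ∀ t : ℕ, ∀ X ∈ S,
      ∫⁻ sel, min (finishTime X sel) t ∂processLaw s G ≤ ENNReal.ofReal (Ψ X / κ) := by
    intro t
    induction t with
    | zero => intro X _; simp
    | succ t ih =>
      intro X hX
      by_cases hc : ∃ i : ℤ, ∀ v, X v = i
      · obtain ⟨i, hi⟩ := hc
        simp [finishTime_consensus hi]
      rw [lintegral_processLaw s G ((measurable_finishTime X).min measurable_const)]
      have hle : ∀ e, ∫⁻ ω, min (finishTime X (consSel e ω)) ((t + 1 : ℕ) : ENNReal) ∂processLaw s G
          ≤ ENNReal.ofReal (Ψ (step X e) / κ + 1) := fun e => by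
        calc _ ≤ ∫⁻ ω, (min (finishTime (step X e) ω) t + 1) ∂processLaw s G := by
              refine lintegral_mono fun ω => ?_
              rw [← min_add_add_right]
              push_cast
              exact min_le_min_right _ (finishTime_consSel_le X e ω)
          _ = ∫⁻ ω, min (finishTime (step X e) ω) t ∂processLaw s G + 1 := by
              rw [lintegral_add_right _ measurable_const]; simp
          _ ≤ ENNReal.ofReal (Ψ (step X e) / κ) + 1 := by gcongr; exact ih _ (hS X hX e)
          _ = _ := by
              rw [ENNReal.ofReal_add (div_nonneg (hΨ _ (hS X hX e)) hκ.le) zero_le_one]; simp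
      calc _ ≤ ∑ e, selection s G e * ENNReal.ofReal (Ψ (step X e) / κ + 1) := by
            gcongr with e; exact hle e
        _ = ∑ e, ENNReal.ofReal ((selection s G e).toReal * (Ψ (step X e) / κ + 1)) := by
            refine Finset.sum_congr rfl fun e _ => ?_
            rw [ENNReal.ofReal_mul ENNReal.toReal_nonneg,
              ENNReal.ofReal_toReal (PMF.apply_ne_top _ _)]
        _ = ENNReal.ofReal (∑ e, (selection s G e).toReal * (Ψ (step X e) / κ + 1)) := by
            rw [ENNReal.ofReal_sum_of_nonneg]
            intro e _
            have := div_nonneg (hΨ _ (hS X hX e)) hκ.le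
            positivity
        _ ≤ _ := by
            refine ENNReal.ofReal_le_ofReal ?_
            have h := hdrift X hX hc
            have h1 : ∑ e, (selection s G e).toReal * (Ψ (step X e) / κ + 1) =
                stepExp s G Ψ X / κ + 1 := by
              simp only [mul_add, Finset.sum_add_distrib, mul_one, sum_selection, stepExp,
                Finset.sum_div, mul_div_assoc]
            rw [h1, div_add_one hκ.ne']
            gcongr
            linarith
  have hsup : ∀ a : ENNReal, a = ⨆ t : ℕ, min a t := fun a => by
    rw [← inf_iSup_eq, ENNReal.iSup_natCast]; simp
  rw [expectedTime, lintegral_congr fun sel => hsup (finishTime X sel), lintegral_iSup]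
  · exact iSup_le fun t => key t X hX
  · exact fun t => (measurable_finishTime X).min measurable_const
  · intro a b hab sel
    exact min_le_min_left _ (by exact_mod_cast hab)

end

section

/-! ### The maximum principle -/

/-- The configurations with all opinions between `lo` and `hi`. -/
def box (n : ℕ) (lo hi : ℤ) : Set (Fin n → ℤ) := {X | ∀ v, lo ≤ X v ∧ X v ≤ hi}

variable {n : ℕ} {lo hi : ℤ}

lemma finite_box (n : ℕ) (lo hi : ℤ) : (box n lo hi).Finite := by
  have : box n lo hi = Set.Icc (fun _ => lo) (fun _ => hi) := by
    ext X; simp [box, Pi.le_def, forall_and]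
  rw [this]; exact Set.finite_Icc _ _

lemma newOpinion_mem {x y : ℤ} (hx : lo ≤ x ∧ x ≤ hi) (hy : lo ≤ y ∧ y ≤ hi) :
    lo ≤ newOpinion x y ∧ newOpinion x y ≤ hi := by
  unfold newOpinion; split_ifs <;> omega

lemma step_mem_box {X : Fin n → ℤ} (hX : X ∈ box n lo hi) (e : Fin n × Fin n) :
    step X e ∈ box n lo hi := by
  intro v
  by_cases hv : v = e.1
  · subst hv
    simpa [step] using newOpinion_mem (hX e.1) (hX e.2)
  · simpa [step, hv] using hX v

variable [NeZero n] (s : Scheme) (G : SimpleGraph (Fin n))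

lemma stepExp_add (f g : (Fin n → ℤ) → ℝ) (X : Fin n → ℤ) :
    stepExp s G (fun Y => f Y + g Y) X = stepExp s G f X + stepExp s G g X := by
  simp [stepExp, mul_add, Finset.sum_add_distrib]

lemma stepExp_sub (f g : (Fin n → ℤ) → ℝ) (X : Fin n → ℤ) :
    stepExp s G (fun Y => f Y - g Y) X = stepExp s G f X - stepExp s G g X := by
  simp [stepExp, mul_sub, Finset.sum_sub_distrib]

lemma stepExp_const_mul (a : ℝ) (f : (Fin n → ℤ) → ℝ) (X : Fin n → ℤ) :
    stepExp s G (fun Y => a * f Y) X = a * stepExp s G f X := by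
  simp only [stepExp, Finset.mul_sum]
  exact Finset.sum_congr rfl fun e _ => by ring

lemma stepExp_const (a : ℝ) (X : Fin n → ℤ) : stepExp s G (fun _ => a) X = a := by
  simp [stepExp, ← Finset.sum_mul, sum_selection]

lemma stepExp_mono {f g : (Fin n → ℤ) → ℝ} {X : Fin n → ℤ} (h : ∀ e, f (step X e) ≤ g (step X e)) :
    stepExp s G f X ≤ stepExp s G g X :=
  Finset.sum_le_sum fun e _ => mul_le_mul_of_nonneg_left (h e) ENNReal.toReal_nonneg

/-- A function that is superharmonic off `D` and nonnegative on `D` is nonnegative, if some `Ψ` is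
strictly superharmonic off `D`. -/
lemma nonneg_of_superharmonic {D : Set (Fin n → ℤ)} {Ψ F : (Fin n → ℤ) → ℝ}
    (hΨ : ∀ X ∈ box n lo hi, X ∉ D → stepExp s G Ψ X < Ψ X)
    (hF : ∀ X ∈ box n lo hi, X ∉ D → stepExp s G F X ≤ F X)
    (hD : ∀ X ∈ box n lo hi, X ∈ D → 0 ≤ F X) {X : Fin n → ℤ} (hX : X ∈ box n lo hi) :
    0 ≤ F X := by
  obtain ⟨Z, -, hZ⟩ := (finite_box n lo hi).exists_minimalFor Ψ _ ⟨X, hX⟩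
  have hlow : ∀ Y ∈ box n lo hi, Ψ Z ≤ Ψ Y := fun Y hY => by
    by_contra! h
    exact absurd (hZ hY h.le) (not_le.2 h)
  -- the minimum of `F + η Ψ` is attained on `D`
  have key : ∀ η : ℝ, 0 < η → η * Ψ Z ≤ F X + η * Ψ X := by
    intro η hη
    obtain ⟨Y, hY, hmin⟩ :=
      (finite_box n lo hi).exists_minimalFor (fun Y => F Y + η * Ψ Y) _ ⟨X, hX⟩
    have hmin' : ∀ W ∈ box n lo hi, F Y + η * Ψ Y ≤ F W + η * Ψ W := fun W hW => by
      by_contra! h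
      exact absurd (hmin hW h.le) (not_le.2 h)
    have hYD : Y ∈ D := by
      by_contra hYD
      have h1 : F Y + η * Ψ Y ≤ stepExp s G (fun W => F W + η * Ψ W) Y := by
        rw [← stepExp_const s G (F Y + η * Ψ Y) Y]
        exact stepExp_mono s G fun e => hmin' _ (step_mem_box hY e)
      rw [stepExp_add, stepExp_const_mul] at h1
      have h2 := hF Y hY hYD
      have h3 := mul_lt_mul_of_pos_left (hΨ Y hY hYD) hη
      linarith
    have h1 := hD Y hY hYD
    have h2 := mul_le_mul_of_nonneg_left (hlow Y hY) hη.le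
    linarith [hmin' X hX]
  have hd : 0 ≤ Ψ X - Ψ Z := sub_nonneg.2 (hlow X hX)
  by_contra! hneg
  have h := key (-F X / (2 * (Ψ X - Ψ Z + 1))) (by apply div_pos <;> linarith)
  have h2 : -F X / (2 * (Ψ X - Ψ Z + 1)) * (Ψ X - Ψ Z) ≤ -F X / 2 := by
    rw [div_mul_eq_mul_div, div_le_div_iff₀ (by linarith) (by norm_num)]
    nlinarith
  linarith

end

section

/-! ### The potential of the extreme opinions -/

/-- The quadratic gain from the concavity of the square root. Only decrements need it: for increments
the tangent bound `sqrt_add_le` is enough. -/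
lemma sqrt_sub_le {a h : ℝ} (h0 : 0 ≤ h) (ha : 0 < a) (hle : h ≤ a) :
    √(a - h) ≤ √a - h / (2 * √a) - h ^ 2 / (8 * (a * √a)) := by
  obtain ⟨x, hx, rfl⟩ : ∃ x : ℝ, 0 < x ∧ a = x ^ 2 :=
    ⟨√a, Real.sqrt_pos.2 ha, (Real.sq_sqrt ha.le).symm⟩
  rw [Real.sqrt_sq hx.le]
  refine Real.sqrt_le_iff.2 ⟨?_, ?_⟩
  · have h1 : h / (2 * x) ≤ x / 2 := by rw [div_le_div_iff₀ (by positivity) (by norm_num)]; nlinarith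
    have h2 : h ^ 2 / (8 * (x ^ 2 * x)) ≤ x / 8 := by
      rw [div_le_div_iff₀ (by positivity) (by norm_num)]
      nlinarith [mul_self_le_mul_self h0 hle]
    linarith
  · have : (x - h / (2 * x) - h ^ 2 / (8 * (x ^ 2 * x))) ^ 2 =
        x ^ 2 - h + (h ^ 3 / (8 * x ^ 4) + h ^ 4 / (64 * x ^ 6)) := by
      field_simp; ring
    rw [this]
    have : 0 ≤ h ^ 3 / (8 * x ^ 4) + h ^ 4 / (64 * x ^ 6) := by positivity
    linarith

lemma sqrt_add_le {a h : ℝ} (h0 : 0 ≤ h) (ha : 0 < a) : √(a + h) ≤ √a + h / (2 * √a) := by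
  obtain ⟨x, hx, rfl⟩ : ∃ x : ℝ, 0 < x ∧ a = x ^ 2 :=
    ⟨√a, Real.sqrt_pos.2 ha, (Real.sq_sqrt ha.le).symm⟩
  rw [Real.sqrt_sq hx.le]
  refine Real.sqrt_le_iff.2 ⟨by positivity, ?_⟩
  have : (x + h / (2 * x)) ^ 2 = x ^ 2 + h + (h / (2 * x)) ^ 2 := by field_simp; ring
  rw [this]
  linarith [sq_nonneg (h / (2 * x))]

variable {n : ℕ}

/-- The vertices with opinion `j`. -/
def level (X : Fin n → ℤ) (j : ℤ) : Finset (Fin n) := Finset.univ.filter fun v => X v = j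

@[simp] lemma mem_level {X : Fin n → ℤ} {j : ℤ} {v : Fin n} : v ∈ level X j ↔ X v = j := by
  simp [level]

lemma le_step {X : Fin n → ℤ} {j : ℤ} (h : ∀ v, j ≤ X v) (e : Fin n × Fin n) (v : Fin n) :
    j ≤ step X e v := by
  have h1 := h e.1
  have h2 := h e.2
  have h3 := h v
  unfold step newOpinion
  rw [Function.update_apply]
  split_ifs <;> omega

/-- The effect of one step on the level set of the smallest opinion `j`. -/
lemma level_step {X : Fin n → ℤ} {j : ℤ} (h : ∀ v, j ≤ X v) (e : Fin n × Fin n) :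
    level (step X e) j =
      if e.1 ∈ level X j ∧ e.2 ∈ (level X j)ᶜ then (level X j).erase e.1
      else if e.1 ∈ level X (j + 1) ∧ e.2 ∈ level X j then insert e.1 (level X j)
      else level X j := by
  have h1 := h e.1
  have h2 := h e.2
  ext v
  have h3 : v ∈ level (step X e) j ↔ (if v = e.1 then newOpinion (X e.1) (X e.2) else X v) = j := by
    rw [mem_level, step, Function.update_apply]
  rw [h3]
  unfold newOpinion
  simp only [mem_level, Finset.mem_compl]
  split_ifs <;> simp only [Finset.mem_erase, Finset.mem_insert, mem_level] <;> grind

lemma step_neg (X : Fin n → ℤ) (e : Fin n × Fin n) : step (-X) e = -step X e := by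
  ext v
  simp only [step, Function.update_apply, Pi.neg_apply, newOpinion]
  split_ifs <;> omega

lemma level_neg (X : Fin n → ℤ) (j : ℤ) : level (-X) j = level X (-j) := by
  ext v; simp [neg_eq_iff_eq_neg]

variable [NeZero n]

/-- Vertex weights for which the selection satisfies detailed balance, and which are comparable to
the uniform weights. -/
structure IsBalanced (s : Scheme) (G : SimpleGraph (Fin n)) (w : Fin n → ℝ) : Prop where
  sum_eq_one : ∑ v, w v = 1
  lower : ∀ v, 1 / (2 * n) ≤ w v
  upper : ∀ v, w v ≤ 2 / n
  balance : ∀ u v, u ≠ v →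
    w u * (selection s G (u, v)).toReal = w v * (selection s G (v, u)).toReal

/-- The stationary rate at which a vertex of `A` is selected to observe a vertex of `B`. -/
noncomputable def flow (s : Scheme) (G : SimpleGraph (Fin n)) (w : Fin n → ℝ)
    (A B : Finset (Fin n)) : ℝ :=
  ∑ e : Fin n × Fin n, if e.1 ∈ A ∧ e.2 ∈ B then w e.1 * (selection s G e).toReal else 0

/-- The expansion that the voting process needs: sets that hold at most half of the vertices have
large boundary, and any two disjoint sets of at least `δ n` vertices are well connected. -/
structure IsExpanding (s : Scheme) (G : SimpleGraph (Fin n)) (w : Fin n → ℝ) (δ : ℝ) : Prop where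
  boundary : ∀ A : Finset (Fin n), 2 * A.card ≤ n → A.card / (16 * (n : ℝ) ^ 2) ≤ flow s G w A Aᶜ
  large : ∀ A B : Finset (Fin n), Disjoint A B → δ * n ≤ A.card → δ * n ≤ B.card →
    δ ^ 2 / (16 * n) ≤ flow s G w A B

/-- The smallest opinion. -/
def lowest (X : Fin n → ℤ) : ℤ := Finset.univ.inf' ⟨0, Finset.mem_univ _⟩ X

/-- The potential of the smallest opinion. The term `- lowest X` makes up for the jump of the square
root when the smallest opinion disappears. -/
noncomputable def lowPotential (w : Fin n → ℝ) (X : Fin n → ℤ) : ℝ :=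
  √(∑ v ∈ level X (lowest X), w v) - lowest X

lemma lowest_le (X : Fin n → ℤ) (v : Fin n) : lowest X ≤ X v :=
  Finset.inf'_le _ (Finset.mem_univ v)

lemma exists_eq_lowest (X : Fin n → ℤ) : ∃ v, X v = lowest X := by
  obtain ⟨v, -, hv⟩ := Finset.exists_mem_eq_inf' (s := Finset.univ) ⟨0, Finset.mem_univ _⟩ X
  exact ⟨v, hv.symm⟩

variable {s : Scheme} {G : SimpleGraph (Fin n)} {w : Fin n → ℝ}

lemma IsBalanced.pos (hw : IsBalanced s G w) (v : Fin n) : 0 < w v := by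
  have : (0 : ℝ) < n := by exact_mod_cast Nat.pos_of_ne_zero (NeZero.ne n)
  exact lt_of_lt_of_le (by positivity) (hw.lower v)

lemma IsBalanced.sum_le_one (hw : IsBalanced s G w) (A : Finset (Fin n)) : ∑ v ∈ A, w v ≤ 1 := by
  rw [← hw.sum_eq_one]
  exact Finset.sum_le_univ_sum_of_nonneg fun v => (hw.pos v).le

/-- This also covers the case that no vertex holds the lower bound `j` any more: then the potential is
at most `1 - (j + 1)`. -/
lemma lowPotential_le (hw : IsBalanced s G w) {X : Fin n → ℤ} {j : ℤ} (h : ∀ v, j ≤ X v) :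
    lowPotential w X ≤ √(∑ v ∈ level X j, w v) - j := by
  obtain ⟨v, hv⟩ := exists_eq_lowest X
  rcases (hv ▸ h v : j ≤ lowest X).eq_or_lt with hj | hj
  · rw [hj]; rfl
  · have h1 : √(∑ v ∈ level X (lowest X), w v) ≤ 1 := Real.sqrt_le_one.2 (hw.sum_le_one _)
    have h2 : (j : ℝ) + 1 ≤ lowest X := by exact_mod_cast hj
    have h3 := Real.sqrt_nonneg (∑ v ∈ level X j, w v)
    unfold lowPotential
    linarith

lemma flow_nonneg (hw : IsBalanced s G w) (A B : Finset (Fin n)) : 0 ≤ flow s G w A B :=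
  Finset.sum_nonneg fun e _ => by
    split_ifs
    · exact mul_nonneg (hw.pos _).le ENNReal.toReal_nonneg
    · rfl

lemma flow_comm (hw : IsBalanced s G w) {A B : Finset (Fin n)} (h : Disjoint A B) :
    flow s G w A B = flow s G w B A := by
  unfold flow
  refine Finset.sum_equiv (Equiv.prodComm (Fin n) (Fin n)) (by simp) fun e _ => ?_
  by_cases he : e.1 ∈ A ∧ e.2 ∈ B
  · exact (if_pos he).trans ((hw.balance e.1 e.2 fun h' =>
      Finset.disjoint_left.1 h he.1 (h' ▸ he.2)).trans (if_pos he.symm).symm)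
  · exact (if_neg he).trans (if_neg fun h' => he h'.symm).symm

lemma flow_union (A : Finset (Fin n)) {B C : Finset (Fin n)} (h : Disjoint B C) :
    flow s G w A (B ∪ C) = flow s G w A B + flow s G w A C := by
  unfold flow
  rw [← Finset.sum_add_distrib]
  refine Finset.sum_congr rfl fun e _ => ?_
  have h1 : e.2 ∈ B → e.2 ∉ C := fun hb => Finset.disjoint_left.1 h hb
  simp only [Finset.mem_union]
  by_cases ha : e.1 ∈ A <;> by_cases hb : e.2 ∈ B <;> by_cases hc : e.2 ∈ C <;> simp_all

lemma flow_mono (hw : IsBalanced s G w) (A : Finset (Fin n)) {B C : Finset (Fin n)} (h : B ⊆ C) :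
    flow s G w A B ≤ flow s G w A C := by
  refine Finset.sum_le_sum fun e _ => ?_
  have h1 : 0 ≤ w e.1 * (selection s G e).toReal := mul_nonneg (hw.pos _).le ENNReal.toReal_nonneg
  have h2 := @h e.2
  split_ifs <;> grind

/-- The drift of the potential of the smallest opinion. The first gain is the loss of mass to the
vertices `B` that are at least two above the smallest opinion, the second one comes from the
concavity of the square root. -/
lemma stepExp_lowPotential_le (hw : IsBalanced s G w) (X : Fin n → ℤ) {B : Finset (Fin n)}
    (hB : ∀ v ∈ B, lowest X + 2 ≤ X v) :
    stepExp s G (lowPotential w) X ≤ lowPotential w X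
      - flow s G w (level X (lowest X)) B / (2 * √(∑ v ∈ level X (lowest X), w v))
      - flow s G w (level X (lowest X)) (level X (lowest X))ᶜ / (16 * n *
        ((∑ v ∈ level X (lowest X), w v) * √(∑ v ∈ level X (lowest X), w v))) := by
  have hn : (0 : ℝ) < n := by exact_mod_cast Nat.pos_of_ne_zero (NeZero.ne n)
  set j := lowest X with hj
  set A := level X j with hA
  set C := level X (j + 1) with hC
  set a := ∑ v ∈ A, w v with ha
  have hge : ∀ v, j ≤ X v := lowest_le X
  have hapos : 0 < a := by
    obtain ⟨v, hv⟩ := exists_eq_lowest X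
    exact Finset.sum_pos (fun v _ => hw.pos v) ⟨v, by simpa [hA] using hv⟩
  have hx : 0 < √a := Real.sqrt_pos.2 hapos
  have hpt : ∀ e : Fin n × Fin n, lowPotential w (step X e) ≤ (√a - j)
      + (if e.1 ∈ C ∧ e.2 ∈ A then w e.1 else 0) / (2 * √a)
      - (if e.1 ∈ A ∧ e.2 ∈ Aᶜ then w e.1 else 0) / (2 * √a)
      - (if e.1 ∈ A ∧ e.2 ∈ Aᶜ then w e.1 else 0) / (16 * n * (a * √a)) := by
    intro e
    refine (lowPotential_le hw (le_step hge e)).trans ?_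
    rw [level_step hge e, ← hA, ← hC]
    by_cases h1 : e.1 ∈ A ∧ e.2 ∈ Aᶜ
    · have h2 : ¬ (e.1 ∈ C ∧ e.2 ∈ A) := fun h => (Finset.mem_compl.1 h1.2) h.2
      have hle : w e.1 ≤ a := Finset.single_le_sum (fun v _ => (hw.pos v).le) h1.1
      rw [if_pos h1, if_neg h2, if_pos h1, Finset.sum_erase_eq_sub h1.1, ← ha]
      have h3 := sqrt_sub_le (hw.pos e.1).le hapos hle
      have h4 : w e.1 / (16 * n * (a * √a)) ≤ w e.1 ^ 2 / (8 * (a * √a)) := by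
        rw [show w e.1 ^ 2 / (8 * (a * √a)) = w e.1 / (8 * (a * √a)) * w e.1 by ring,
          show w e.1 / (16 * n * (a * √a)) = w e.1 / (8 * (a * √a)) * (1 / (2 * n)) by
            field_simp; ring]
        have := (hw.pos e.1).le
        exact mul_le_mul_of_nonneg_left (hw.lower e.1) (by positivity)
      simp only [zero_div]
      linarith
    · rw [if_neg h1, if_neg h1]
      by_cases h2 : e.1 ∈ C ∧ e.2 ∈ A
      · have h3 : e.1 ∉ A := by
          have := h2.1
          simp only [hC, hA, mem_level] at this ⊢
          omega
        rw [if_pos h2, if_pos h2, Finset.sum_insert h3, ← ha, add_comm (w e.1)]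
        have h4 := sqrt_add_le (hw.pos e.1).le hapos
        simp only [zero_div]
        linarith
      · rw [if_neg h2, if_neg h2, ← ha]; simp
  have hflow : ∀ S T : Finset (Fin n), ∑ e : Fin n × Fin n,
      (selection s G e).toReal * (if e.1 ∈ S ∧ e.2 ∈ T then w e.1 else 0) = flow s G w S T :=
    fun S T => Finset.sum_congr rfl fun e _ => by split_ifs <;> ring
  have hsum : stepExp s G (lowPotential w) X ≤ (√a - j) + flow s G w C A / (2 * √a)
      - flow s G w A Aᶜ / (2 * √a) - flow s G w A Aᶜ / (16 * n * (a * √a)) := by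
    refine (Finset.sum_le_sum fun e _ =>
      mul_le_mul_of_nonneg_left (hpt e) ENNReal.toReal_nonneg).trans_eq ?_
    simp only [mul_add, mul_sub, Finset.sum_add_distrib, Finset.sum_sub_distrib, ← mul_div_assoc,
      ← Finset.sum_div, ← Finset.sum_mul, sum_selection, hflow, one_mul]
  have hAC : Disjoint A C := Finset.disjoint_left.2 fun v h1 h2 => by
    simp only [hA, hC, mem_level] at h1 h2; omega
  have hCB : Disjoint C B := Finset.disjoint_left.2 fun v h1 h2 => by
    have := hB v h2
    simp only [hC, mem_level] at h1; omega
  have hsub : C ∪ B ⊆ Aᶜ := by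
    intro v hv
    rw [Finset.mem_compl, hA, mem_level]
    rcases Finset.mem_union.1 hv with h | h
    · simp only [hC, mem_level] at h; omega
    · have := hB v h; omega
  have h1 := flow_mono hw A hsub
  rw [flow_union A hCB, flow_comm hw hAC] at h1
  have h2 : flow s G w A B / (2 * √a) ≤
      flow s G w A Aᶜ / (2 * √a) - flow s G w C A / (2 * √a) := by
    rw [← sub_div]; gcongr; linarith
  have h3 : lowPotential w X = √a - j := rfl
  rw [h3]
  linarith

lemma stepExp_lowPotential_le_self (hw : IsBalanced s G w) (X : Fin n → ℤ) :
    stepExp s G (lowPotential w) X ≤ lowPotential w X := by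
  have h := stepExp_lowPotential_le hw X (B := ∅) (by simp)
  have h1 : 0 ≤ ∑ v ∈ level X (lowest X), w v := Finset.sum_nonneg fun v _ => (hw.pos v).le
  have h2 := div_nonneg (flow_nonneg hw (level X (lowest X)) ∅)
    (by positivity : 0 ≤ 2 * √(∑ v ∈ level X (lowest X), w v))
  have h3 := div_nonneg (flow_nonneg hw (level X (lowest X)) (level X (lowest X))ᶜ)
    (by positivity : 0 ≤ 16 * n *
      ((∑ v ∈ level X (lowest X), w v) * √(∑ v ∈ level X (lowest X), w v)))
  linarith

/-- If few vertices hold the smallest opinion, then its potential has a strong negative drift from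
the fluctuations of its mass. -/
lemma stepExp_lowPotential_le_of_card_le (hw : IsBalanced s G w) {δ : ℝ} (hG : IsExpanding s G w δ)
    {X : Fin n → ℤ} {ρ : ℝ} (hρ : ρ ≤ 1 / 2) (hcard : (level X (lowest X)).card ≤ ρ * n) :
    stepExp s G (lowPotential w) X ≤
      lowPotential w X - 1 / (512 * √(2 * ρ)) / (n : ℝ) ^ 2 := by
  have hn : (0 : ℝ) < n := by exact_mod_cast Nat.pos_of_ne_zero (NeZero.ne n)
  have h := stepExp_lowPotential_le hw X (B := ∅) (by simp)
  set A := level X (lowest X) with hA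
  set a := ∑ v ∈ A, w v with ha
  have hne : A.Nonempty := by
    obtain ⟨v, hv⟩ := exists_eq_lowest X
    exact ⟨v, by simpa [hA] using hv⟩
  have hapos : 0 < a := Finset.sum_pos (fun v _ => hw.pos v) hne
  have hx : 0 < √a := Real.sqrt_pos.2 hapos
  have hle : a ≤ A.card * (2 / n) := by
    rw [ha, ← nsmul_eq_mul]; exact Finset.sum_le_card_nsmul _ _ _ fun v _ => hw.upper v
  have h2 : 2 * A.card ≤ n := by
    have : (A.card : ℝ) ≤ 1 / 2 * n := hcard.trans (by gcongr)
    have : (2 * A.card : ℝ) ≤ n := by linarith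
    exact_mod_cast this
  have hb := hG.boundary A h2
  have haρ : a ≤ 2 * ρ := by
    refine hle.trans ?_
    rw [mul_div_assoc', div_le_iff₀ hn]; linarith
  have hba : a / (32 * n) ≤ flow s G w A Aᶜ := by
    refine le_trans ?_ hb
    rw [div_le_div_iff₀ (by positivity) (by positivity)]
    have : a * n ≤ A.card * 2 := by
      calc a * n ≤ A.card * (2 / n) * n := by gcongr
        _ = A.card * 2 := by field_simp
    nlinarith
  have h3 := div_nonneg (flow_nonneg hw A ∅) (by positivity : 0 ≤ 2 * √a)
  have h4 : 1 / (512 * √(2 * ρ)) / (n : ℝ) ^ 2 ≤ flow s G w A Aᶜ / (16 * n * (a * √a)) := by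
    calc 1 / (512 * √(2 * ρ)) / (n : ℝ) ^ 2 ≤ 1 / (512 * √a) / (n : ℝ) ^ 2 := by
          gcongr
      _ = a / (32 * n) / (16 * n * (a * √a)) := by field_simp; norm_num
      _ ≤ _ := by gcongr
  linarith

/-- If many vertices hold the smallest opinion and many vertices are at least two above it, then
the potential has a strong negative drift from the loss of mass. -/
lemma stepExp_lowPotential_le_of_le_card (hw : IsBalanced s G w) {δ : ℝ} (hG : IsExpanding s G w δ)
    {X : Fin n → ℤ} {B : Finset (Fin n)} (hB : ∀ v ∈ B, lowest X + 2 ≤ X v)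
    (hA : δ * n ≤ (level X (lowest X)).card) (hBc : δ * n ≤ B.card) :
    stepExp s G (lowPotential w) X ≤ lowPotential w X - δ ^ 2 / (32 * n) := by
  have hn : (0 : ℝ) < n := by exact_mod_cast Nat.pos_of_ne_zero (NeZero.ne n)
  have h := stepExp_lowPotential_le hw X hB
  have hne : (level X (lowest X)).Nonempty := by
    obtain ⟨v, hv⟩ := exists_eq_lowest X
    exact ⟨v, by simpa using hv⟩
  have hdisj : Disjoint (level X (lowest X)) B := Finset.disjoint_left.2 fun v h1 h2 => by
    have := hB v h2
    rw [mem_level] at h1; omega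
  have hl := hG.large _ B hdisj hA hBc
  set A := level X (lowest X)
  set a := ∑ v ∈ A, w v with ha
  have hapos : 0 < a := Finset.sum_pos (fun v _ => hw.pos v) hne
  have hx : 0 < √a := Real.sqrt_pos.2 hapos
  have hx1 : √a ≤ 1 := Real.sqrt_le_one.2 (hw.sum_le_one _)
  have h3 := div_nonneg (flow_nonneg hw A Aᶜ) (by positivity : 0 ≤ 16 * n * (a * √a))
  have h4 : δ ^ 2 / (32 * n) ≤ flow s G w A B / (2 * √a) := by
    calc δ ^ 2 / (32 * n) = δ ^ 2 / (16 * n) / (2 * 1) := by field_simp; ring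
      _ ≤ _ := by gcongr; exact flow_nonneg hw A B
  linarith

/-- The potential of the two extreme opinions. The largest opinion enters as the smallest one of the
negated opinions, which evolve in the same way. -/
noncomputable def potential (w : Fin n → ℝ) (X : Fin n → ℤ) : ℝ :=
  lowPotential w X + lowPotential w (-X)

lemma stepExp_potential (X : Fin n → ℤ) : stepExp s G (potential w) X =
    stepExp s G (lowPotential w) X + stepExp s G (lowPotential w) (-X) := by
  refine (stepExp_add s G (lowPotential w) (fun Y => lowPotential w (-Y)) X).trans ?_
  simp only [stepExp, step_neg]

lemma lowest_add_lowest_neg_le (X : Fin n → ℤ) : lowest X + lowest (-X) ≤ 0 := by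
  have h1 := lowest_le X 0
  have h2 := lowest_le (-X) 0
  rw [Pi.neg_apply] at h2
  omega

lemma potential_nonneg (X : Fin n → ℤ) : 0 ≤ potential w X := by
  have h1 : (lowest X : ℝ) + lowest (-X) ≤ 0 := by exact_mod_cast lowest_add_lowest_neg_le X
  have h2 := Real.sqrt_nonneg (∑ v ∈ level X (lowest X), w v)
  have h3 := Real.sqrt_nonneg (∑ v ∈ level (-X) (lowest (-X)), w v)
  unfold potential lowPotential
  linarith

lemma potential_le (hw : IsBalanced s G w) {k : ℤ} {X : Fin n → ℤ} (hX : X ∈ box n 1 k) :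
    potential w X ≤ k + 1 := by
  have h1 := lowPotential_le hw (j := 1) fun v => (hX v).1
  have h2 := lowPotential_le hw (X := -X) (j := -k) fun v => neg_le_neg (hX v).2
  have h3 : √(∑ v ∈ level X 1, w v) ≤ 1 := Real.sqrt_le_one.2 (hw.sum_le_one _)
  have h4 : √(∑ v ∈ level (-X) (-k), w v) ≤ 1 := Real.sqrt_le_one.2 (hw.sum_le_one _)
  unfold potential
  push_cast at h1 h2
  linarith

lemma stepExp_potential_le_of_card_le (hw : IsBalanced s G w) {δ : ℝ} (hG : IsExpanding s G w δ)
    {X : Fin n → ℤ} {ρ : ℝ} (hρ : ρ ≤ 1 / 2)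
    (h : (level X (lowest X)).card ≤ ρ * n ∨ (level (-X) (lowest (-X))).card ≤ ρ * n) :
    stepExp s G (potential w) X ≤ potential w X - 1 / (512 * √(2 * ρ)) / (n : ℝ) ^ 2 := by
  rw [stepExp_potential, potential]
  rcases h with h | h
  · linarith [stepExp_lowPotential_le_of_card_le hw hG hρ h, stepExp_lowPotential_le_self hw (-X)]
  · linarith [stepExp_lowPotential_le_of_card_le hw hG hρ h, stepExp_lowPotential_le_self hw X]

/-- Without consensus the potential decreases by at least a constant over `n ^ 2` per step. -/
lemma stepExp_potential_le_of_not_consensus (hw : IsBalanced s G w) {δ : ℝ}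
    (hG : IsExpanding s G w δ) {X : Fin n → ℤ} (hX : ¬ ∃ i : ℤ, ∀ v, X v = i) :
    stepExp s G (potential w) X ≤ potential w X - 1 / 512 / (n : ℝ) ^ 2 := by
  have hlt : lowest X + lowest (-X) < 0 := by
    refine (lowest_add_lowest_neg_le X).lt_of_ne fun h => hX ⟨lowest X, fun v => ?_⟩
    have h1 := lowest_le X v
    have h2 := lowest_le (-X) v
    rw [Pi.neg_apply] at h2
    omega
  have hdisj : Disjoint (level X (lowest X)) (level (-X) (lowest (-X))) :=
    Finset.disjoint_left.2 fun v h1 h2 => by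
      rw [level_neg, mem_level] at h2; rw [mem_level] at h1; omega
  have hcard : ((level X (lowest X)).card : ℝ) + (level (-X) (lowest (-X))).card ≤ n := by
    rw [← Nat.cast_add, ← Finset.card_union_of_disjoint hdisj]
    exact_mod_cast (Finset.card_le_univ _).trans_eq (Fintype.card_fin n)
  have h := stepExp_potential_le_of_card_le hw hG (X := X) le_rfl (by
    by_contra! h
    linarith [h.1, h.2])
  norm_num at h ⊢
  exact h

/-- If the extreme opinions differ by at least two, then the potential decreases by a large multiple
of `1 / n ^ 2` per step. -/
lemma stepExp_potential_le_of_spread (hw : IsBalanced s G w) {δ : ℝ} (hδ : δ ≤ 1 / 2)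
    (hG : IsExpanding s G w δ) {L : ℝ} (hL1 : L ≤ 1 / (512 * √(2 * δ))) (hL2 : L ≤ δ ^ 2 * n / 32)
    {X : Fin n → ℤ} (hX : ¬ ∃ j : ℤ, X ∈ box n j (j + 1)) :
    stepExp s G (potential w) X ≤ potential w X - L / (n : ℝ) ^ 2 := by
  have hn : (0 : ℝ) < n := by exact_mod_cast Nat.pos_of_ne_zero (NeZero.ne n)
  by_cases h : (level X (lowest X)).card ≤ δ * n ∨ (level (-X) (lowest (-X))).card ≤ δ * n
  · have h1 := stepExp_potential_le_of_card_le hw hG hδ h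
    have h2 : L / (n : ℝ) ^ 2 ≤ 1 / (512 * √(2 * δ)) / (n : ℝ) ^ 2 := by gcongr
    linarith
  · push Not at h
    have hlt : lowest X + lowest (-X) + 2 ≤ 0 := by
      by_contra! hlt
      refine hX ⟨lowest X, fun v => ⟨lowest_le X v, ?_⟩⟩
      have h2 := lowest_le (-X) v
      rw [Pi.neg_apply] at h2
      omega
    have h1 := stepExp_lowPotential_le_of_le_card hw hG (X := X)
      (B := level (-X) (lowest (-X))) (fun v hv => by
        rw [level_neg, mem_level] at hv; omega) h.1.le h.2.le
    have h2 := stepExp_lowPotential_le_self hw (-X)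
    have h3 : L / (n : ℝ) ^ 2 ≤ δ ^ 2 / (32 * n) := by
      calc L / (n : ℝ) ^ 2 ≤ δ ^ 2 * n / 32 / (n : ℝ) ^ 2 := by gcongr
        _ = _ := by field_simp
    rw [stepExp_potential, potential]
    linarith

end

section

/-! ### The weighted average of the opinions -/

/-- The weighted average of the opinions. -/
noncomputable def weightedAverage {n : ℕ} (w : Fin n → ℝ) (X : Fin n → ℤ) : ℝ := ∑ v, w v * X v

/-- The increment of the opinion of the updated vertex. -/
def increment {n : ℕ} (X : Fin n → ℤ) (e : Fin n × Fin n) : ℤ := newOpinion (X e.1) (X e.2) - X e.1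

section
variable {n : ℕ}

lemma increment_swap (X : Fin n → ℤ) (e : Fin n × Fin n) :
    increment X e.swap = -increment X e := by
  simp only [increment, newOpinion, Prod.fst_swap, Prod.snd_swap]
  split_ifs <;> omega

lemma increment_sq_le (X : Fin n → ℤ) (e : Fin n × Fin n) : (increment X e : ℝ) ^ 2 ≤ 1 := by
  have : increment X e = 0 ∨ increment X e = 1 ∨ increment X e = -1 := by
    simp only [increment, newOpinion]
    split_ifs <;> omega
  rcases this with h | h | h <;> simp [h]

lemma weightedAverage_step (w : Fin n → ℝ) (X : Fin n → ℤ) (e : Fin n × Fin n) :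
    weightedAverage w (step X e) = weightedAverage w X + w e.1 * increment X e := by
  have h : ∀ v, w v * (step X e v : ℝ) = w v * X v + if v = e.1 then w e.1 * increment X e else 0 :=
    fun v => by
      by_cases hv : v = e.1
      · subst hv; simp [step, increment]; ring
      · simp [step, hv]
  simp only [weightedAverage, h, Finset.sum_add_distrib]
  simp

end

variable {n : ℕ} [NeZero n] {s : Scheme} {G : SimpleGraph (Fin n)} {w : Fin n → ℝ}

lemma sum_increment (hw : IsBalanced s G w) (X : Fin n → ℤ) :
    ∑ e, (selection s G e).toReal * (w e.1 * increment X e) = 0 := by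
  have h : ∑ e, (selection s G e).toReal * (w e.1 * increment X e) =
      ∑ e, -((selection s G e).toReal * (w e.1 * increment X e)) := by
    refine Finset.sum_equiv (Equiv.prodComm (Fin n) (Fin n)) (by simp) fun e _ => ?_
    have h1 := increment_swap X e
    by_cases he : e.1 = e.2
    · have h2 : increment X e = 0 := by simp [increment, newOpinion, he]
      simp [h1, h2]
    · have h2 := hw.balance e.1 e.2 he
      have h3 : w e.1 * (selection s G e).toReal = w e.2 * (selection s G e.swap).toReal := h2
      simp only [Equiv.prodComm_apply, Prod.fst_swap, h1]
      push_cast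
      linear_combination (increment X e : ℝ) * h3
  rw [Finset.sum_neg_distrib] at h
  linarith

/-- The weighted average is a martingale. -/
lemma stepExp_weightedAverage (hw : IsBalanced s G w) (X : Fin n → ℤ) :
    stepExp s G (weightedAverage w) X = weightedAverage w X := by
  simp only [stepExp, weightedAverage_step, mul_add, Finset.sum_add_distrib, sum_increment hw,
    ← Finset.sum_mul, sum_selection]
  ring

lemma stepExp_weightedAverage_sq_le (hw : IsBalanced s G w) (m : ℝ) (X : Fin n → ℤ) :
    stepExp s G (fun Y => (weightedAverage w Y - m) ^ 2) X ≤
      (weightedAverage w X - m) ^ 2 + 4 / (n : ℝ) ^ 2 := by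
  have hle : ∀ e : Fin n × Fin n, (w e.1 * increment X e) ^ 2 ≤ 4 / (n : ℝ) ^ 2 := fun e => by
    have h1 : w e.1 ^ 2 ≤ (2 / n) ^ 2 := pow_le_pow_left₀ (hw.pos _).le (hw.upper _) 2
    rw [mul_pow]
    calc _ ≤ (2 / n : ℝ) ^ 2 * 1 :=
          mul_le_mul h1 (increment_sq_le X e) (sq_nonneg _) (sq_nonneg _)
      _ = _ := by ring
  calc _ = ∑ e, ((selection s G e).toReal * (weightedAverage w X - m) ^ 2
        + 2 * (weightedAverage w X - m) * ((selection s G e).toReal * (w e.1 * increment X e))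
        + (selection s G e).toReal * (w e.1 * increment X e) ^ 2) := by
        refine Finset.sum_congr rfl fun e _ => ?_
        beta_reduce
        rw [weightedAverage_step]; ring
    _ = (weightedAverage w X - m) ^ 2
        + ∑ e, (selection s G e).toReal * (w e.1 * increment X e) ^ 2 := by
        rw [Finset.sum_add_distrib, Finset.sum_add_distrib, ← Finset.sum_mul, sum_selection,
          ← Finset.mul_sum, sum_increment hw]
        ring
    _ ≤ _ := by
        gcongr
        calc _ ≤ ∑ e, (selection s G e).toReal * (4 / (n : ℝ) ^ 2) :=
              Finset.sum_le_sum fun e _ => mul_le_mul_of_nonneg_left (hle e) ENNReal.toReal_nonneg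
          _ = _ := by rw [← Finset.sum_mul, sum_selection, one_mul]

lemma weightedAverage_mem (hw : IsBalanced s G w) {X : Fin n → ℤ} {lo hi : ℤ}
    (hX : X ∈ box n lo hi) : lo ≤ weightedAverage w X ∧ weightedAverage w X ≤ hi := by
  have h : ∀ c : ℝ, c = ∑ v, w v * c := fun c => by rw [← Finset.sum_mul, hw.sum_eq_one, one_mul]
  constructor
  · rw [h lo]
    exact Finset.sum_le_sum fun v _ =>
      mul_le_mul_of_nonneg_left (by exact_mod_cast (hX v).1) (hw.pos v).le
  · rw [h hi]
    exact Finset.sum_le_sum fun v _ =>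
      mul_le_mul_of_nonneg_left (by exact_mod_cast (hX v).2) (hw.pos v).le

/-! ### The winning probabilities -/

/-- The piecewise linear interpolation of the indicator function of the integer `i`. -/
noncomputable def tent (i : ℤ) (x : ℝ) : ℝ := max 0 (1 - |x - i|)

lemma abs_tent_sub_le (i : ℤ) (x y : ℝ) : |tent i x - tent i y| ≤ |x - y| := by
  have h := abs_max_sub_max_le_abs (1 - |x - i|) (1 - |y - i|) 0
  rw [max_comm _ (0 : ℝ), max_comm _ (0 : ℝ)] at h
  refine h.trans ?_
  rw [show 1 - |x - i| - (1 - |y - i|) = |y - i| - |x - i| by ring]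
  refine (abs_abs_sub_abs_le _ _).trans_eq ?_
  rw [show y - i - (x - i) = -(x - y) by ring, abs_neg]

lemma tent_intCast (i j : ℤ) : tent i j = if j = i then 1 else 0 := by
  unfold tent
  split_ifs with h
  · simp [h]
  · have : (1 : ℝ) ≤ |(j : ℝ) - i| := by
      have : 1 ≤ |j - i| := Int.one_le_abs (sub_ne_zero.2 h)
      exact_mod_cast this
    exact max_eq_left (by linarith)

/-- The function `tent i` is affine between consecutive integers. -/
lemma tent_eq_of_mem (i j : ℤ) {x : ℝ} (h1 : j ≤ x) (h2 : x ≤ j + 1) :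
    tent i x = tent i j + (tent i (j + 1 : ℤ) - tent i j) * (x - j) := by
  rw [tent_intCast, tent_intCast]
  rcases lt_trichotomy j i with h | rfl | h
  · have hx : x ≤ i := h2.trans (by exact_mod_cast h)
    rw [if_neg h.ne, tent, abs_of_nonpos (by linarith)]
    by_cases hj : j + 1 = i
    · rw [if_pos hj, ← hj, max_eq_right]
      · push_cast; ring
      · push_cast; linarith
    · rw [if_neg hj, max_eq_left]
      · simp
      · have : ((j + 1 : ℤ) : ℝ) + 1 ≤ i := by exact_mod_cast (by omega : j + 1 + 1 ≤ i)
        push_cast at this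
        linarith
  · rw [if_pos rfl, if_neg (by omega), tent, abs_of_nonneg (by linarith), max_eq_right]
    · ring
    · linarith
  · have : (i : ℝ) + 1 ≤ j := by exact_mod_cast h
    rw [if_neg h.ne', if_neg (by omega), tent, abs_of_nonneg (by linarith), max_eq_left]
    · simp
    · linarith

lemma stepExp_affine (hw : IsBalanced s G w) (a b : ℝ) (X : Fin n → ℤ) :
    stepExp s G (fun Y => a + b * weightedAverage w Y) X = a + b * weightedAverage w X := by
  rw [stepExp_add s G (fun _ => a) (fun Y => b * weightedAverage w Y), stepExp_const,
    stepExp_const_mul, stepExp_weightedAverage hw]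

/-- Between two consecutive opinions the winning probabilities follow from optional stopping. -/
lemma winProb_eq_tent (hw : IsBalanced s G w) {δ : ℝ} (hG : IsExpanding s G w δ) (i : ℤ)
    {X : Fin n → ℤ} {j : ℤ} (hX : X ∈ box n j (j + 1)) :
    winProb s G X i = tent i (weightedAverage w X) := by
  have hn : (0 : ℝ) < n := by exact_mod_cast Nat.pos_of_ne_zero (NeZero.ne n)
  have hΨ : ∀ Y ∈ box n j (j + 1), Y ∉ {Y : Fin n → ℤ | ∃ i : ℤ, ∀ v, Y v = i} →
      stepExp s G (potential w) Y < potential w Y := fun Y _ hY =>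
    (stepExp_potential_le_of_not_consensus hw hG hY).trans_lt (sub_lt_self _ (by positivity))
  set b := tent i (j + 1 : ℤ) - tent i j with hb
  set a := tent i j - b * j with ha
  have hten : ∀ Y ∈ box n j (j + 1), tent i (weightedAverage w Y) = a + b * weightedAverage w Y :=
    fun Y hY => by
      obtain ⟨h1, h2⟩ := weightedAverage_mem hw hY
      push_cast at h2
      rw [tent_eq_of_mem i j h1 h2]
      ring
  have hcons : ∀ Y ∈ box n j (j + 1), Y ∈ {Y : Fin n → ℤ | ∃ i : ℤ, ∀ v, Y v = i} →
      winProb s G Y i = a + b * weightedAverage w Y := by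
    rintro Y hY ⟨l, hl⟩
    rw [← hten Y hY, winProb_consensus s G hl, weightedAverage]
    simp only [hl, ← Finset.sum_mul, hw.sum_eq_one, one_mul, tent_intCast]
  have h1 := nonneg_of_superharmonic s G hΨ
    (F := fun Y => winProb s G Y i - (a + b * weightedAverage w Y))
    (fun Y _ _ => (by
      rw [stepExp_sub s G (fun Y => winProb s G Y i), stepExp_affine hw, stepExp_winProb]))
    (fun Y hY hc => (by rw [hcons Y hY hc, sub_self])) hX
  have h2 := nonneg_of_superharmonic s G hΨ
    (F := fun Y => (a + b * weightedAverage w Y) - winProb s G Y i)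
    (fun Y _ _ => (by
      rw [stepExp_sub s G _ (fun Y => winProb s G Y i), stepExp_affine hw, stepExp_winProb]))
    (fun Y hY hc => (by rw [hcons Y hY hc, sub_self])) hX
  rw [hten X hX]
  exact le_antisymm (sub_nonneg.1 h2) (sub_nonneg.1 h1)

lemma abs_le_add_sq_div (x : ℝ) {τ : ℝ} (hτ : 0 < τ) : |x| ≤ τ + x ^ 2 / τ := by
  have : |x| * τ ≤ (τ + x ^ 2 / τ) * τ := by
    rw [add_mul, div_mul_cancel₀ _ hτ.ne', ← sq_abs x]
    nlinarith [sq_nonneg (|x| - τ), sq_nonneg (|x| - τ / 2)]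
  exact le_of_mul_le_mul_right this hτ

/-- The winning probabilities are close to those of a process that starts with two consecutive
opinions, since the weighted average hardly moves until only two consecutive opinions are left. -/
lemma abs_winProb_sub_tent_le (hw : IsBalanced s G w) {δ : ℝ} (hδ : δ ≤ 1 / 2)
    (hG : IsExpanding s G w δ) {L : ℝ} (hL : 0 < L) (hL1 : L ≤ 1 / (512 * √(2 * δ)))
    (hL2 : L ≤ δ ^ 2 * n / 32) {τ : ℝ} (hτ : 0 < τ) {k i : ℤ} {X : Fin n → ℤ}
    (hX : X ∈ box n 1 k) :
    |winProb s G X i - tent i (weightedAverage w X)| ≤ τ + 4 * (k + 1) / (L * τ) := by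
  have hn : (0 : ℝ) < n := by exact_mod_cast Nat.pos_of_ne_zero (NeZero.ne n)
  set m := weightedAverage w X with hm
  set D : Set (Fin n → ℤ) := {Y | ∃ j : ℤ, Y ∈ box n j (j + 1)} with hD
  have hdrift : ∀ Y, Y ∉ D → stepExp s G (potential w) Y ≤ potential w Y - L / (n : ℝ) ^ 2 :=
    fun Y hY => stepExp_potential_le_of_spread hw hδ hG hL1 hL2 hY
  have hΨ : ∀ Y ∈ box n 1 k, Y ∉ D → stepExp s G (potential w) Y < potential w Y := fun Y _ hY =>
    (hdrift Y hY).trans_lt (sub_lt_self _ (by positivity))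
  -- The variance that the weighted average picks up in a step is paid for by the potential.
  set R : (Fin n → ℤ) → ℝ := fun Y =>
    1 / τ * (weightedAverage w Y - m) ^ 2 + 4 / (L * τ) * potential w Y with hR
  have hRstep : ∀ Y, Y ∉ D → stepExp s G R Y ≤ R Y := fun Y hY => by
    have h1 := stepExp_weightedAverage_sq_le hw m Y
    have h2 := hdrift Y hY
    rw [hR, stepExp_add s G (fun Y => 1 / τ * (weightedAverage w Y - m) ^ 2)
      (fun Y => 4 / (L * τ) * potential w Y), stepExp_const_mul, stepExp_const_mul]
    have h3 : 1 / τ * (4 / (n : ℝ) ^ 2) = 4 / (L * τ) * (L / (n : ℝ) ^ 2) := by field_simp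
    have h4 := mul_le_mul_of_nonneg_left h1 (by positivity : 0 ≤ 1 / τ)
    have h5 := mul_le_mul_of_nonneg_left h2 (by positivity : 0 ≤ 4 / (L * τ))
    rw [mul_add] at h4
    rw [mul_sub] at h5
    linarith
  have hend : ∀ Y ∈ D, |winProb s G Y i - tent i m| ≤ τ + R Y := by
    rintro Y ⟨j, hj⟩
    rw [winProb_eq_tent hw hG i hj]
    refine (abs_tent_sub_le _ _ _).trans ((abs_le_add_sq_div _ hτ).trans ?_)
    have : 0 ≤ 4 / (L * τ) * potential w Y := mul_nonneg (by positivity) (potential_nonneg Y)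
    have h' : (weightedAverage w Y - m) ^ 2 / τ = 1 / τ * (weightedAverage w Y - m) ^ 2 := by ring
    simp only [hR]
    linarith
  have hstart : R X ≤ 4 * (k + 1) / (L * τ) := by
    have h1 := mul_le_mul_of_nonneg_left (potential_le hw hX) (by positivity : 0 ≤ 4 / (L * τ))
    simp only [hR, ← hm, sub_self]
    calc _ = 4 / (L * τ) * potential w X := by ring
      _ ≤ _ := h1
      _ = _ := by ring
  have h1 := nonneg_of_superharmonic s G hΨ
    (F := fun Y => (tent i m + τ + R Y) - winProb s G Y i)
    (fun Y _ hY => (by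
      rw [stepExp_sub s G (fun Y => tent i m + τ + R Y) (fun Y => winProb s G Y i),
        stepExp_winProb, stepExp_add s G (fun _ => tent i m + τ), stepExp_const]
      linarith [hRstep Y hY]))
    (fun Y _ hc => (by linarith [(abs_le.1 (hend Y hc)).2])) hX
  have h2 := nonneg_of_superharmonic s G hΨ
    (F := fun Y => (-tent i m + τ + R Y) + winProb s G Y i)
    (fun Y _ hY => (by
      rw [stepExp_add s G (fun Y => -tent i m + τ + R Y) (fun Y => winProb s G Y i),
        stepExp_winProb, stepExp_add s G (fun _ => -tent i m + τ), stepExp_const]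
      linarith [hRstep Y hY]))
    (fun Y _ hc => (by linarith [(abs_le.1 (hend Y hc)).1])) hX
  rw [abs_le]
  constructor <;> linarith

lemma expectedTime_le_of_isExpanding (hw : IsBalanced s G w) {δ : ℝ} (hG : IsExpanding s G w δ)
    {k : ℤ} {X : Fin n → ℤ} (hX : X ∈ box n 1 k) :
    expectedTime s G X ≤ ENNReal.ofReal (512 * (k + 1)) * (n : ENNReal) ^ 2 := by
  have hn : (0 : ℝ) < n := by exact_mod_cast Nat.pos_of_ne_zero (NeZero.ne n)
  have h := expectedTime_le s G (S := box n 1 k) (fun Y hY e => step_mem_box hY e)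
    (fun Y _ => potential_nonneg (w := w) Y) (κ := 1 / 512 / (n : ℝ) ^ 2) (by positivity)
    (fun Y _ hY => stepExp_potential_le_of_not_consensus hw hG hY) hX
  refine h.trans ?_
  have h1 : (n : ENNReal) ^ 2 = ENNReal.ofReal ((n : ℝ) ^ 2) := by
    rw [ENNReal.ofReal_pow hn.le, ENNReal.ofReal_natCast]
  rw [h1, ← ENNReal.ofReal_mul']
  · refine ENNReal.ofReal_le_ofReal ?_
    rw [div_div, div_div_eq_mul_div, div_one]
    have := potential_le hw hX
    have : 0 ≤ ((n : ℝ) ^ 2) := by positivity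
    nlinarith
  · positivity

end

section

/-! ### Typical graphs -/

section
variable {n : ℕ} (G : SimpleGraph (Fin n))

open Classical in
/-- The number of edges between `A` and `B`, for disjoint sets `A` and `B`; in general, the number
of ordered pairs in `A × B` that are adjacent. -/
noncomputable def edgesBetween (A B : Finset (Fin n)) : ℕ :=
  ((A ×ˢ B).filter fun e => G.Adj e.1 e.2).card

open Classical in
/-- The degree of a vertex. -/
noncomputable def deg (v : Fin n) : ℕ := (Finset.univ.filter fun u => G.Adj v u).card

/-- The properties of a random graph that the voting process needs: all degrees are close to some
`d`, and the number of edges between two sets is at least a constant fraction of its expectation for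
complementary sets and for sets of linear size. -/
def IsTypical (θ δ : ℝ) : Prop :=
  ∃ d : ℝ, 0 < d ∧ (∀ v, (1 - θ) * d ≤ deg G v ∧ deg G v ≤ (1 + θ) * d) ∧
    (∀ A : Finset (Fin n), 2 * A.card ≤ n → d * A.card / 4 ≤ edgesBetween G A Aᶜ) ∧
    (∀ A B : Finset (Fin n), Disjoint A B → δ * n ≤ A.card → δ * n ≤ B.card →
      δ ^ 2 * d * n / 4 ≤ edgesBetween G A B)

open Classical in
lemma card_adj_eq_sum_deg :
    (Finset.univ.filter fun e : Fin n × Fin n => G.Adj e.1 e.2).card = ∑ v, deg G v := by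
  simp only [deg, Finset.card_filter, Fintype.sum_prod_type]

variable [NeZero n]

open Classical in
lemma toReal_selection_edge (hG : 0 < ∑ v, deg G v) (u v : Fin n) :
    (selection .edge G (u, v)).toReal = if G.Adj u v then 1 / (∑ v, (deg G v : ℝ)) else 0 := by
  have h : (Finset.univ.filter fun e : Fin n × Fin n => G.Adj e.1 e.2).Nonempty := by
    rw [← Finset.card_pos, card_adj_eq_sum_deg]; exact hG
  rw [selection, dif_pos h, PMF.uniformOfFinset_apply]
  simp only [Finset.mem_filter, Finset.mem_univ, true_and, card_adj_eq_sum_deg]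
  rw [← Nat.cast_sum]
  split_ifs
  · rw [ENNReal.toReal_inv, ENNReal.toReal_natCast, one_div]
  · simp

open Classical in
lemma toReal_selection_vertex (hG : ∀ v, 0 < deg G v) (u v : Fin n) :
    (selection .vertex G (u, v)).toReal = if G.Adj u v then 1 / (n * deg G u : ℝ) else 0 := by
  have h : ∀ v, (Finset.univ.filter fun u => G.Adj v u).Nonempty := fun v => by
    rw [← Finset.card_pos]; exact hG v
  have h1 : ∀ u', (PMF.map (fun w => (u', w)) (PMF.uniformOfFinset _ (h u'))) (u, v) =
      if u' = u then (if G.Adj u v then ((deg G u : ENNReal))⁻¹ else 0) else 0 := by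
    intro u'
    rw [PMF.map_apply]
    split_ifs with h1 h2
    · subst h1
      rw [tsum_eq_single v]
      · simp [PMF.uniformOfFinset_apply, h2, deg]
      · intro w hw; rw [if_neg]; simpa using hw.symm
    · subst h1
      rw [tsum_eq_single v]
      · simp [PMF.uniformOfFinset_apply, h2]
      · intro w hw; rw [if_neg]; simpa using hw.symm
    · rw [ENNReal.tsum_eq_zero]
      intro w
      rw [if_neg]
      rintro ⟨⟩
      exact h1 rfl
  rw [selection, PMF.bind_apply, tsum_fintype]
  simp only [h, dite_true, h1, PMF.uniformOfFintype_apply, Fintype.card_fin]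
  rw [Finset.sum_eq_single u (fun b _ hb => by rw [if_neg hb, mul_zero]) (by simp), if_pos rfl]
  split_ifs
  · simp [mul_comm]
  · simp

/-- The stationary weights of the vertices: the uniform weights in the edge process, and weights
proportional to the degrees in the vertex process. -/
noncomputable def weight (s : Scheme) (v : Fin n) : ℝ :=
  match s with
  | .edge => 1 / n
  | .vertex => deg G v / (∑ u, (deg G u : ℝ))

open Classical in
lemma weight_mul_selection (s : Scheme) (hG : ∀ v, 0 < deg G v) (u v : Fin n) :
    weight G s u * (selection s G (u, v)).toReal =
      if G.Adj u v then 1 / (n * ∑ u, (deg G u : ℝ)) else 0 := by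
  have hn : (0 : ℝ) < n := by exact_mod_cast Nat.pos_of_ne_zero (NeZero.ne n)
  have hsum : 0 < ∑ v, deg G v := Finset.sum_pos (fun v _ => hG v) ⟨0, Finset.mem_univ _⟩
  have hsum' : (0 : ℝ) < ∑ v, (deg G v : ℝ) := by exact_mod_cast hsum
  have hu : (0 : ℝ) < deg G u := by exact_mod_cast hG u
  cases s with
  | edge =>
    rw [toReal_selection_edge G hsum, weight]
    split_ifs
    · field_simp
    · simp
  | vertex =>
    rw [toReal_selection_vertex G hG, weight]
    split_ifs
    · field_simp
    · simp

open Classical in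
lemma flow_eq (s : Scheme) (hG : ∀ v, 0 < deg G v) (A B : Finset (Fin n)) :
    flow s G (weight G s) A B = 1 / (n * ∑ u, (deg G u : ℝ)) * edgesBetween G A B := by
  have h : ∀ e : Fin n × Fin n, (if e.1 ∈ A ∧ e.2 ∈ B then
      weight G s e.1 * (selection s G e).toReal else 0) =
      if e ∈ (A ×ˢ B).filter (fun e => G.Adj e.1 e.2) then 1 / (n * ∑ u, (deg G u : ℝ)) else 0 := by
    intro e
    rw [weight_mul_selection G s hG e.1 e.2, ← ite_and]
    simp only [Finset.mem_filter, Finset.mem_product]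
  rw [flow, Finset.sum_congr rfl fun e _ => h e, Finset.sum_ite_mem, Finset.univ_inter,
    Finset.sum_const, nsmul_eq_mul, mul_comm, edgesBetween]

end

variable {n : ℕ} {G : SimpleGraph (Fin n)} {θ δ : ℝ}

lemma IsTypical.deg_pos (hG : IsTypical G θ δ) (hθ : θ ≤ 1 / 4) (v : Fin n) : 0 < deg G v := by
  obtain ⟨d, hd, h, -⟩ := hG
  have : (0 : ℝ) < deg G v := lt_of_lt_of_le (by nlinarith) (h v).1
  exact_mod_cast this

lemma sum_deg_mem {d : ℝ} (h : ∀ v, (1 - θ) * d ≤ deg G v ∧ deg G v ≤ (1 + θ) * d) :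
    n * ((1 - θ) * d) ≤ ∑ v, (deg G v : ℝ) ∧ ∑ v, (deg G v : ℝ) ≤ n * ((1 + θ) * d) := by
  constructor
  · have := Finset.card_nsmul_le_sum Finset.univ (fun v => (deg G v : ℝ)) _ fun v _ => (h v).1
    simpa using this
  · have := Finset.sum_le_card_nsmul Finset.univ (fun v => (deg G v : ℝ)) _ fun v _ => (h v).2
    simpa using this

lemma sum_deg_pos [NeZero n] {d : ℝ} (hd : 0 < d) (hθ : θ ≤ 1 / 4)
    (h : ∀ v, (1 - θ) * d ≤ deg G v ∧ deg G v ≤ (1 + θ) * d) : 0 < ∑ v, (deg G v : ℝ) := by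
  have hn : (0 : ℝ) < n := by exact_mod_cast Nat.pos_of_ne_zero (NeZero.ne n)
  have hθ1 : 0 < 1 - θ := by linarith
  exact lt_of_lt_of_le (by positivity) (sum_deg_mem h).1

variable [NeZero n]

/-- The stationary weights of a typical graph are almost uniform. -/
lemma IsTypical.abs_weight_sub_le (hG : IsTypical G θ δ) (hθ0 : 0 ≤ θ) (hθ : θ ≤ 1 / 4)
    (s : Scheme) (v : Fin n) : |weight G s v - 1 / n| ≤ (2 * θ / (1 - θ)) / n := by
  have hn : (0 : ℝ) < n := by exact_mod_cast Nat.pos_of_ne_zero (NeZero.ne n)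
  have hθ1 : 0 < 1 - θ := by linarith
  cases s with
  | edge => simp only [weight, sub_self, abs_zero]; positivity
  | vertex =>
    obtain ⟨d, hd, h, -⟩ := hG
    obtain ⟨h1, h2⟩ := sum_deg_mem h
    obtain ⟨h3, h4⟩ := h v
    set D := ∑ u, (deg G u : ℝ) with hD
    have hD0 : 0 < D := lt_of_lt_of_le (by positivity) h1
    have h5 : weight G .vertex v - 1 / n = (n * deg G v - D) / (n * D) := by
      rw [weight, ← hD]; field_simp
    have h6 : |n * deg G v - D| ≤ n * (2 * θ * d) := by
      rw [abs_le]
      constructor <;> nlinarith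
    rw [h5, abs_div, abs_of_pos (by positivity : 0 < n * D)]
    calc _ ≤ n * (2 * θ * d) / (n * (n * ((1 - θ) * d))) := by gcongr
      _ = _ := by field_simp

lemma IsTypical.isBalanced (hG : IsTypical G θ δ) (hθ : θ ≤ 1 / 4) (s : Scheme) :
    IsBalanced s G (weight G s) := by
  have hn : (0 : ℝ) < n := by exact_mod_cast Nat.pos_of_ne_zero (NeZero.ne n)
  refine ⟨?_, fun v => ?_, fun v => ?_, fun u v _ => ?_⟩
  · cases s with
    | edge => simp [weight]
    | vertex =>
      simp only [weight]
      rw [← Finset.sum_div, div_self]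
      have : 0 < ∑ v, deg G v :=
        Finset.sum_pos (fun v _ => hG.deg_pos hθ v) ⟨0, Finset.mem_univ _⟩
      exact_mod_cast this.ne'
  · cases s with
    | edge => simp only [weight]; gcongr; linarith
    | vertex =>
      obtain ⟨d, hd, h, -⟩ := hG
      have h2 := (sum_deg_mem h).2
      have h3 := (h v).1
      have hD0 : 0 < ∑ u, (deg G u : ℝ) := sum_deg_pos hd hθ h
      rw [weight, div_le_div_iff₀ (by positivity) hD0]
      have h4 : (n : ℝ) * ((1 + θ) * d) ≤ n * (2 * ((1 - θ) * d)) :=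
        mul_le_mul_of_nonneg_left (by nlinarith) hn.le
      nlinarith
  · cases s with
    | edge => simp only [weight]; gcongr; norm_num
    | vertex =>
      obtain ⟨d, hd, h, -⟩ := hG
      have h2 := (sum_deg_mem h).1
      have h3 := (h v).2
      have hD0 : 0 < ∑ u, (deg G u : ℝ) := sum_deg_pos hd hθ h
      rw [weight, div_le_div_iff₀ hD0 (by positivity)]
      have h4 : (n : ℝ) * ((1 + θ) * d) ≤ n * (2 * ((1 - θ) * d)) :=
        mul_le_mul_of_nonneg_left (by nlinarith) hn.le
      nlinarith
  · classical
    rw [weight_mul_selection G s (hG.deg_pos hθ), weight_mul_selection G s (hG.deg_pos hθ),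
      G.adj_comm]

lemma IsTypical.isExpanding (hG : IsTypical G θ δ) (hθ : θ ≤ 1 / 4) (s : Scheme) :
    IsExpanding s G (weight G s) δ := by
  have hn : (0 : ℝ) < n := by exact_mod_cast Nat.pos_of_ne_zero (NeZero.ne n)
  have hpos := hG.deg_pos hθ
  obtain ⟨d, hd, h, hb, hl⟩ := hG
  obtain ⟨h1, h2⟩ := sum_deg_mem h
  have hD0 : 0 < ∑ u, (deg G u : ℝ) := sum_deg_pos hd hθ h
  have hκ : 1 / (4 * (n : ℝ) ^ 2 * d) ≤ 1 / (n * ∑ u, (deg G u : ℝ)) := by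
    have : (n : ℝ) * ((1 + θ) * d) ≤ n * (4 * d) := by gcongr; linarith
    refine one_div_le_one_div_of_le (by positivity) ?_
    nlinarith
  refine ⟨fun A hA => ?_, fun A B hAB hA hB => ?_⟩
  · rw [flow_eq G s hpos]
    calc (A.card : ℝ) / (16 * (n : ℝ) ^ 2) = 1 / (4 * (n : ℝ) ^ 2 * d) * (d * A.card / 4) := by
          field_simp; norm_num
      _ ≤ _ := by gcongr; exact hb A hA
  · rw [flow_eq G s hpos]
    calc δ ^ 2 / (16 * n) = 1 / (4 * (n : ℝ) ^ 2 * d) * (δ ^ 2 * d * n / 4) := by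
          field_simp; norm_num
      _ ≤ _ := by gcongr; exact hl A B hAB hA hB

/-- On a typical graph the weighted average is close to the average. -/
lemma IsTypical.abs_weightedAverage_sub_le (hG : IsTypical G θ δ) (hθ0 : 0 ≤ θ) (hθ : θ ≤ 1 / 4)
    (s : Scheme) {k : ℤ} {X : Fin n → ℤ} (hX : X ∈ box n 1 k) :
    |weightedAverage (weight G s) X - average X| ≤ 4 * θ * k := by
  have hn : (0 : ℝ) < n := by exact_mod_cast Nat.pos_of_ne_zero (NeZero.ne n)
  have h : weightedAverage (weight G s) X - average X =
      ∑ v, (weight G s v - 1 / n) * X v := by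
    simp only [weightedAverage, average, sub_mul, Finset.sum_sub_distrib, Finset.sum_div]
    congr 1
    exact Finset.sum_congr rfl fun v _ => by ring
  have hθ' : 2 * θ / (1 - θ) ≤ 4 * θ := by
    rw [div_le_iff₀ (by linarith)]; nlinarith
  have hterm : ∀ v ∈ Finset.univ, |(weight G s v - 1 / n) * X v| ≤ 4 * θ / n * k := by
    intro v _
    have h1 : (1 : ℝ) ≤ X v := by exact_mod_cast (hX v).1
    have h2 : (X v : ℝ) ≤ k := by exact_mod_cast (hX v).2
    rw [abs_mul, abs_of_pos (by linarith : (0 : ℝ) < X v)]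
    refine mul_le_mul ((hG.abs_weight_sub_le hθ0 hθ s v).trans ?_) h2 (by linarith) (by positivity)
    gcongr
  rw [h]
  refine (Finset.abs_sum_le_sum_abs _ _).trans ((Finset.sum_le_sum hterm).trans_eq ?_)
  rw [Finset.sum_const, Finset.card_univ, Fintype.card_fin, nsmul_eq_mul]
  field_simp

end

section

/-! ### Random graphs are typical -/

open Classical in
lemma integral_setBernoulli_pow_card {ι : Type*} [Fintype ι] (E F : Finset ι)
    (hF : F ⊆ E) (p : unitInterval) (x : ℝ) :
    ∫ S : Set ι, x ^ (F.filter fun e => e ∈ S).card ∂(setBernoulli (E : Set ι) p) =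
      (1 + p * (x - 1)) ^ F.card := by
  rw [integral_fintype (Integrable.of_finite), ← Fintype.finsetEquivSet.sum_comp]
  have h1 : ∀ S : Finset ι, (setBernoulli (E : Set ι) p).real {Fintype.finsetEquivSet S} •
      x ^ (F.filter fun e => e ∈ Fintype.finsetEquivSet S).card =
      if S ∈ E.powerset then (∏ e ∈ S, (p : ℝ) * if e ∈ F then x else 1) * ∏ e ∈ E \ S, (1 - p : ℝ)
      else 0 := by
    intro S
    rw [Fintype.finsetEquivSet_apply]
    split_ifs with hS
    · rw [Finset.mem_powerset] at hS
      rw [setBernoulli_real_singleton p (by exact_mod_cast hS) E.finite_toSet, ← Finset.coe_sdiff,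
        Set.ncard_coe_finset, Set.ncard_coe_finset, Finset.prod_mul_distrib, Finset.prod_const,
        Finset.prod_const, ← Finset.prod_filter, Finset.prod_const, smul_eq_mul]
      simp only [Finset.mem_coe]
      rw [Finset.filter_mem_eq_inter, Finset.filter_mem_eq_inter, Finset.inter_comm]
      ring
    · rw [Finset.mem_powerset] at hS
      rw [measureReal_def, setBernoulli_singleton_of_not_subset p (by exact_mod_cast hS)]
      simp
  rw [Finset.sum_congr rfl fun S _ => h1 S, Finset.sum_ite_mem, Finset.univ_inter,
    ← Finset.prod_add]
  calc _ = ∏ e ∈ E, if e ∈ F then 1 + (p : ℝ) * (x - 1) else 1 :=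
        Finset.prod_congr rfl fun e _ => by split_ifs <;> ring
    _ = _ := by
        rw [← Finset.prod_filter, Finset.prod_const, Finset.filter_mem_eq_inter,
          Finset.inter_eq_right.2 hF]

section
variable {n : ℕ}

instance : MeasurableSingletonClass (SimpleGraph (Fin n)) where
  measurableSet_singleton G := by
    rw [← SimpleGraph.measurableEmbedding_edgeSet.measurableSet_image, Set.image_singleton]
    exact measurableSet_singleton _

/-- The number of edges between two disjoint sets is binomially distributed, which is expressed
here by its probability generating function. -/
lemma integral_pow_edgesBetween {A B : Finset (Fin n)} (h : Disjoint A B) (p : unitInterval)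
    (x : ℝ) : ∫ G, x ^ edgesBetween G A B ∂(SimpleGraph.binomialRandom (Fin n) p) =
      (1 + p * (x - 1)) ^ (A.card * B.card) := by
  classical
  set F : Finset (Sym2 (Fin n)) := (A ×ˢ B).image fun e => s(e.1, e.2) with hF
  have hinj : Set.InjOn (fun e : Fin n × Fin n => s(e.1, e.2)) (A ×ˢ B : Finset _) := by
    rintro ⟨a, b⟩ h1 ⟨c, d⟩ h2 h3
    rw [Finset.mem_coe, Finset.mem_product] at h1 h2
    rcases Sym2.eq_iff.1 h3 with h3 | h3
    · exact Prod.ext h3.1 h3.2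
    · exact absurd h2.2 (Finset.disjoint_left.1 h (h3.1 ▸ h1.1))
  have hcard : F.card = A.card * B.card := by
    rw [hF, Finset.card_image_of_injOn hinj, Finset.card_product]
  have hdiag : ∀ e ∈ F, e ∈ (Sym2.diagSetᶜ : Set (Sym2 (Fin n))) := by
    intro e he
    obtain ⟨⟨a, b⟩, hab, rfl⟩ := Finset.mem_image.1 he
    rw [Finset.mem_product] at hab
    simp only [Set.mem_compl_iff, Sym2.mem_diagSet, Sym2.mk_isDiag_iff]
    rintro rfl
    exact Finset.disjoint_left.1 h hab.1 hab.2
  have hcount : ∀ S : Set (Sym2 (Fin n)),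
      edgesBetween (SimpleGraph.fromEdgeSet S) A B = (F.filter fun e => e ∈ S).card := by
    intro S
    rw [edgesBetween, hF, Finset.filter_image, Finset.card_image_of_injOn
      (hinj.mono (by exact_mod_cast Finset.filter_subset _ _))]
    congr 1
    ext ⟨a, b⟩
    simp only [Finset.mem_filter, Finset.mem_product, SimpleGraph.fromEdgeSet_adj]
    constructor
    · rintro ⟨h1, h2, -⟩; exact ⟨h1, h2⟩
    · rintro ⟨h1, h2⟩
      exact ⟨h1, h2, fun h3 => Finset.disjoint_left.1 h h1.1 (h3 ▸ h1.2)⟩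
  rw [SimpleGraph.binomialRandom_eq_map, integral_map (by fun_prop)
    (AEStronglyMeasurable.of_discrete)]
  simp only [hcount]
  rw [← hcard, ← Set.coe_toFinset (Sym2.diagSetᶜ : Set (Sym2 (Fin n)))]
  exact integral_setBernoulli_pow_card _ F (fun e he => Set.mem_toFinset.2 (hdiag e he)) p x

lemma mgf_edgesBetween_le {A B : Finset (Fin n)} (h : Disjoint A B) (p : unitInterval) {t : ℝ}
    (ht : |t| ≤ 1) :
    mgf (fun G => (edgesBetween G A B : ℝ)) (SimpleGraph.binomialRandom (Fin n) p) t ≤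
      Real.exp (A.card * B.card * p * (t + t ^ 2)) := by
  have h1 : mgf (fun G => (edgesBetween G A B : ℝ)) (SimpleGraph.binomialRandom (Fin n) p) t =
      (1 + p * (Real.exp t - 1)) ^ (A.card * B.card) := by
    rw [← integral_pow_edgesBetween h p, mgf]
    refine integral_congr_ae (Filter.Eventually.of_forall fun G => ?_)
    simp only [mul_comm t, Real.exp_nat_mul]
  have hp0 : (0 : ℝ) ≤ p := p.2.1
  have hp1 : (p : ℝ) ≤ 1 := p.2.2
  have h2 : Real.exp t - 1 ≤ t + t ^ 2 := by
    have := (abs_le.1 (Real.abs_exp_sub_one_sub_id_le ht)).2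
    linarith
  have h3 : 0 ≤ 1 + p * (Real.exp t - 1) := by nlinarith [Real.exp_pos t]
  rw [h1]
  calc _ ≤ Real.exp (p * (t + t ^ 2)) ^ (A.card * B.card) := by
        refine pow_le_pow_left₀ h3 ?_ _
        have := Real.add_one_le_exp (p * (t + t ^ 2))
        have := mul_le_mul_of_nonneg_left h2 hp0
        linarith
    _ = _ := by
        rw [← Real.exp_nat_mul]
        push_cast
        ring_nf

/-- Chernoff's bound for the lower tail. -/
lemma prob_edgesBetween_le {A B : Finset (Fin n)} (h : Disjoint A B) (p : unitInterval) {θ : ℝ}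
    (hθ0 : 0 ≤ θ) (hθ : θ ≤ 1) :
    (SimpleGraph.binomialRandom (Fin n) p).real
      {G | (edgesBetween G A B : ℝ) ≤ (1 - θ) * (A.card * B.card * p)} ≤
      Real.exp (-(θ ^ 2 / 4 * (A.card * B.card * p))) := by
  have ht : |-(θ / 2)| ≤ 1 := by rw [abs_neg, abs_of_nonneg (by linarith)]; linarith
  refine (measure_le_le_exp_mul_mgf _ (t := -(θ / 2)) (by linarith) Integrable.of_finite).trans ?_
  refine (mul_le_mul_of_nonneg_left (mgf_edgesBetween_le h p ht) (Real.exp_pos _).le).trans_eq ?_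
  rw [← Real.exp_add]
  ring_nf

/-- Chernoff's bound for the upper tail. -/
lemma prob_le_edgesBetween {A B : Finset (Fin n)} (h : Disjoint A B) (p : unitInterval) {θ : ℝ}
    (hθ0 : 0 ≤ θ) (hθ : θ ≤ 1) :
    (SimpleGraph.binomialRandom (Fin n) p).real
      {G | (1 + θ) * (A.card * B.card * p) ≤ (edgesBetween G A B : ℝ)} ≤
      Real.exp (-(θ ^ 2 / 4 * (A.card * B.card * p))) := by
  have ht : |θ / 2| ≤ 1 := by rw [abs_of_nonneg (by linarith)]; linarith
  refine (measure_ge_le_exp_mul_mgf _ (t := θ / 2) (by linarith) Integrable.of_finite).trans ?_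
  refine (mul_le_mul_of_nonneg_left (mgf_edgesBetween_le h p ht) (Real.exp_pos _).le).trans_eq ?_
  rw [← Real.exp_add]
  ring_nf

lemma edgesBetween_singleton (G : SimpleGraph (Fin n)) (v : Fin n) :
    edgesBetween G {v} {v}ᶜ = deg G v := by
  classical
  rw [edgesBetween, deg]
  refine Finset.card_bij (fun e _ => e.2) ?_ ?_ ?_
  · rintro ⟨a, b⟩ hab
    simp only [Finset.mem_filter, Finset.mem_product, Finset.mem_singleton] at hab
    simpa [← hab.1.1] using hab.2
  · rintro ⟨a, b⟩ hab ⟨c, d⟩ hcd h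
    simp only [Finset.mem_filter, Finset.mem_product, Finset.mem_singleton] at hab hcd
    exact Prod.ext (hab.1.1.trans hcd.1.1.symm) h
  · intro u hu
    simp only [Finset.mem_filter, Finset.mem_univ, true_and] at hu
    refine ⟨(v, u), ?_, rfl⟩
    simp [hu, hu.ne']

lemma one_div_sq_eq_exp {x : ℝ} (hx : 0 < x) : 1 / x ^ 2 = Real.exp (-(2 * Real.log x)) := by
  rw [Real.exp_neg, two_mul, Real.exp_add, Real.exp_log hx, one_div, sq]

/-- Each vertex degree is concentrated. -/
lemma prob_deg_le (p : unitInterval) {θ : ℝ} (hθ0 : 0 < θ) (hθ : θ ≤ 1) (hn : 2 / θ ≤ n)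
    (hp : 64 / θ ^ 2 * Real.log n ≤ n * p) (v : Fin n) :
    (SimpleGraph.binomialRandom (Fin n) p).real
      {G | ¬ ((1 - θ) * (n * p) ≤ deg G v ∧ (deg G v : ℝ) ≤ (1 + θ) * (n * p))} ≤
      2 / (n : ℝ) ^ 2 := by
  have hdisj : Disjoint ({v} : Finset (Fin n)) {v}ᶜ := disjoint_compl_right
  have hn2 : 2 ≤ θ * n := by rwa [div_le_iff₀' hθ0] at hn
  have hnpos : (0 : ℝ) < n := by nlinarith
  have hp0 : (0 : ℝ) ≤ p := p.2.1
  have hcard : ((({v} : Finset (Fin n)).card : ℝ) * (({v} : Finset (Fin n))ᶜ.card : ℝ) * p) =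
      (n - 1) * p := by
    rw [Finset.card_compl, Finset.card_singleton, Fintype.card_fin, Nat.cast_sub v.pos]
    simp
  have h1 := prob_edgesBetween_le hdisj p (θ := θ / 2) (by linarith) (by linarith)
  have h2 := prob_le_edgesBetween hdisj p (θ := θ / 2) (by linarith) (by linarith)
  rw [hcard] at h1 h2
  simp only [edgesBetween_singleton] at h1 h2
  have hexp : Real.exp (-((θ / 2) ^ 2 / 4 * ((n - 1) * p))) ≤ 1 / (n : ℝ) ^ 2 := by
    rw [one_div_sq_eq_exp hnpos, Real.exp_le_exp, neg_le_neg_iff]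
    rw [div_mul_eq_mul_div, div_le_iff₀ (by positivity)] at hp
    have h3 : (n : ℝ) * p ≤ 2 * ((n - 1) * p) := by nlinarith
    have h4 : (n : ℝ) * p * θ ^ 2 ≤ 2 * ((n - 1) * p) * θ ^ 2 := by gcongr
    linarith
  calc _ ≤ (SimpleGraph.binomialRandom (Fin n) p).real
        ({G | (deg G v : ℝ) ≤ (1 - θ / 2) * ((n - 1) * p)} ∪
          {G | (1 + θ / 2) * ((n - 1) * p) ≤ (deg G v : ℝ)}) := by
        refine measureReal_mono fun G hG => ?_
        simp only [Set.mem_union, Set.mem_ofPred_eq] at hG ⊢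
        by_contra! hcon
        refine hG ⟨le_trans ?_ hcon.1.le, hcon.2.le.trans ?_⟩
        · have h3 : (1 - θ) * n ≤ (1 - θ / 2) * (n - 1) := by nlinarith
          nlinarith
        · have h3 : (1 + θ / 2) * (n - 1) ≤ (1 + θ) * n := by nlinarith
          nlinarith
    _ ≤ _ := measureReal_union_le _ _
    _ ≤ 1 / (n : ℝ) ^ 2 + 1 / (n : ℝ) ^ 2 := add_le_add (h1.trans hexp) (h2.trans hexp)
    _ = _ := by ring

lemma prob_boundary_le (p : unitInterval) (hn : 1 ≤ n) (hp : 64 * Real.log n ≤ n * p)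
    {A : Finset (Fin n)} (hA : 2 * A.card ≤ n) (hne : A.Nonempty) :
    (SimpleGraph.binomialRandom (Fin n) p).real
      {G | ¬ ((n * p * A.card / 4 : ℝ) ≤ edgesBetween G A Aᶜ)} ≤ (1 / (n : ℝ) ^ 2) ^ A.card := by
  have hnpos : (0 : ℝ) < n := by exact_mod_cast hn
  have hp0 : (0 : ℝ) ≤ p := p.2.1
  have hA' : (2 * A.card : ℝ) ≤ n := by exact_mod_cast hA
  have hA1 : (1 : ℝ) ≤ A.card := by exact_mod_cast hne.card_pos
  have hc : (Aᶜ.card : ℝ) = n - A.card := by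
    rw [Finset.card_compl, Fintype.card_fin, Nat.cast_sub (by omega)]
  have hcard : (n : ℝ) * p * A.card / 2 ≤ A.card * Aᶜ.card * p := by
    have h0 : 0 ≤ (A.card : ℝ) * p := by positivity
    rw [hc]; nlinarith
  have h1 := prob_edgesBetween_le (disjoint_compl_right (a := A)) p (θ := 1 / 2) (by norm_num)
    (by norm_num)
  refine (measureReal_mono fun G hG => ?_).trans (h1.trans ?_)
  · simp only [Set.mem_ofPred_eq, not_le] at hG ⊢
    linarith
  · rw [one_div_sq_eq_exp hnpos, ← Real.exp_nat_mul, Real.exp_le_exp]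
    have := mul_le_mul_of_nonneg_right hp (by positivity : (0 : ℝ) ≤ A.card)
    linarith

lemma prob_large_le (p : unitInterval) {δ : ℝ} (hδ : 0 < δ) (hp : 48 / δ ^ 2 ≤ n * p)
    {A B : Finset (Fin n)} (hAB : Disjoint A B) (hA : δ * n ≤ A.card) (hB : δ * n ≤ B.card) :
    (SimpleGraph.binomialRandom (Fin n) p).real
      {G | ¬ (δ ^ 2 * (n * p) * n / 4 ≤ edgesBetween G A B)} ≤ Real.exp (-3 * n) := by
  have hp0 : (0 : ℝ) ≤ p := p.2.1
  have hcard : δ ^ 2 * (n * p) * n ≤ A.card * B.card * p := by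
    calc δ ^ 2 * (n * p) * n = (δ * n) * (δ * n) * p := by ring
      _ ≤ _ := by gcongr
  have h1 := prob_edgesBetween_le hAB p (θ := 1 / 2) (by norm_num) (by norm_num)
  have h0 : 0 ≤ δ ^ 2 * (n * p) * n := by positivity
  refine (measureReal_mono fun G hG => ?_).trans (h1.trans ?_)
  · simp only [Set.mem_ofPred_eq, not_le] at hG ⊢
    linarith
  · rw [Real.exp_le_exp]
    rw [div_le_iff₀' (by positivity)] at hp
    have : 48 * (n : ℝ) ≤ δ ^ 2 * (n * p) * n := by gcongr
    linarith

/-- The sum over the nonempty sets `A` of `n ^ (-2 |A|)`. -/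
lemma sum_pow_card_le (hn : 1 ≤ n) :
    ∑ A : Finset (Fin n) with A.Nonempty, (1 / (n : ℝ) ^ 2) ^ A.card ≤ 2 / (n : ℝ) := by
  have hnpos : (1 : ℝ) ≤ n := by exact_mod_cast hn
  have h1 : ∑ A : Finset (Fin n), (1 / (n : ℝ) ^ 2) ^ A.card = (1 / (n : ℝ) ^ 2 + 1) ^ n := by
    have := Finset.sum_pow_mul_eq_add_pow (1 / (n : ℝ) ^ 2) 1 (Finset.univ : Finset (Fin n))
    simpa using this
  have h2 : ∑ A : Finset (Fin n) with A.Nonempty, (1 / (n : ℝ) ^ 2) ^ A.card =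
      (1 / (n : ℝ) ^ 2 + 1) ^ n - 1 := by
    rw [← h1, ← Finset.sum_filter_add_sum_filter_not Finset.univ Finset.Nonempty]
    have h : (Finset.univ : Finset (Finset (Fin n))).filter (fun A => ¬ A.Nonempty) = {∅} := by
      ext A; simp
    rw [h, Finset.sum_singleton, Finset.card_empty, pow_zero, add_sub_cancel_right]
  have h3 : (1 / (n : ℝ) ^ 2 + 1) ^ n ≤ Real.exp (1 / n) := by
    calc _ ≤ Real.exp (1 / (n : ℝ) ^ 2) ^ n := by
          gcongr; exact Real.add_one_le_exp _
      _ = _ := by rw [← Real.exp_nat_mul]; congr 1; field_simp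
  have h4 : |(1 : ℝ) / n| ≤ 1 := by
    rw [abs_of_nonneg (by positivity), div_le_one (by positivity)]; exact hnpos
  have h5 := (abs_le.1 (Real.abs_exp_sub_one_sub_id_le h4)).2
  have h6 : (1 / (n : ℝ)) ^ 2 ≤ 1 / n := by
    rw [sq]; exact mul_le_of_le_one_left (by positivity) ((abs_le.1 h4).2)
  rw [h2]
  have : (2 : ℝ) / n = 1 / n + 1 / n := by ring
  linarith

/-- The union bound. The lower bounds on `n p` beat the number of events: `n` for the degrees, at most
`n ^ j` for the boundaries of the sets of size `j`, and `4 ^ n` for the pairs of large sets. -/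
lemma prob_not_isTypical_le (p : unitInterval) {θ δ : ℝ} (hθ0 : 0 < θ) (hθ : θ ≤ 1) (hδ : 0 < δ)
    (hn : 2 / θ ≤ n) (hn3 : 3 ≤ n) (hp : 64 / θ ^ 2 * Real.log n ≤ n * p)
    (hp' : 48 / δ ^ 2 ≤ n * p) :
    (SimpleGraph.binomialRandom (Fin n) p).real {G | ¬ IsTypical G θ δ} ≤ 5 / n := by
  classical
  have hnpos : (0 : ℝ) < n := by exact_mod_cast (by omega : 0 < n)
  have hlog : 0 ≤ Real.log n := Real.log_natCast_nonneg n
  have hp64 : 64 * Real.log n ≤ n * p := by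
    refine le_trans ?_ hp
    gcongr
    rw [le_div_iff₀ (by positivity)]
    nlinarith
  have hd : (0 : ℝ) < n * p := lt_of_lt_of_le (by positivity) hp'
  set μ := SimpleGraph.binomialRandom (Fin n) p with hμ
  set S1 : Fin n → Set (SimpleGraph (Fin n)) := fun v =>
    {G | ¬ ((1 - θ) * (n * p) ≤ deg G v ∧ (deg G v : ℝ) ≤ (1 + θ) * (n * p))} with hS1
  set S2 : Finset (Fin n) → Set (SimpleGraph (Fin n)) := fun A =>
    {G | 2 * A.card ≤ n ∧ ¬ ((n * p * A.card / 4 : ℝ) ≤ edgesBetween G A Aᶜ)} with hS2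
  set S3 : Finset (Fin n) × Finset (Fin n) → Set (SimpleGraph (Fin n)) := fun A =>
    {G | (Disjoint A.1 A.2 ∧ δ * n ≤ A.1.card ∧ δ * n ≤ A.2.card) ∧
      ¬ (δ ^ 2 * (n * p) * n / 4 ≤ edgesBetween G A.1 A.2)} with hS3
  have hsub : {G | ¬ IsTypical G θ δ} ⊆ (⋃ v ∈ Finset.univ, S1 v) ∪
      (⋃ A ∈ Finset.univ.filter Finset.Nonempty, S2 A) ∪ ⋃ A ∈ Finset.univ, S3 A := by
    intro G hG
    by_contra hcon
    simp only [Set.mem_union, Set.mem_iUnion, not_or, not_exists, Finset.mem_univ, true_and,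
      forall_true_left, Finset.mem_filter, hS1, hS2, hS3, Set.mem_ofPred_eq, not_and, not_not] at hcon
    refine hG ⟨n * p, hd, fun v => by have := hcon.1.1 v; tauto, fun A hA => ?_, fun A B h1 h2 h3 => ?_⟩
    · rcases A.eq_empty_or_nonempty with rfl | hne
      · simp
      · exact hcon.1.2 A hne hA
    · exact hcon.2 (A, B) ⟨h1, h2, h3⟩
  have h1 : μ.real (⋃ v ∈ Finset.univ, S1 v) ≤ 2 / n := by
    refine (measureReal_biUnion_finset_le _ _).trans ?_
    refine (Finset.sum_le_sum fun v _ => prob_deg_le p hθ0 hθ hn hp v).trans_eq ?_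
    rw [Finset.sum_const, Finset.card_univ, Fintype.card_fin, nsmul_eq_mul]
    field_simp
  have h2 : μ.real (⋃ A ∈ Finset.univ.filter Finset.Nonempty, S2 A) ≤ 2 / n := by
    refine (measureReal_biUnion_finset_le _ _).trans ?_
    refine (Finset.sum_le_sum fun A hA => ?_).trans (sum_pow_card_le (by omega))
    by_cases hc : 2 * A.card ≤ n
    · refine (measureReal_mono fun G hG => ?_).trans
        (prob_boundary_le p (by omega) hp64 hc (Finset.mem_filter.1 hA).2)
      exact hG.2
    · have : S2 A = ∅ := Set.eq_empty_of_forall_notMem fun G hG => hc hG.1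
      rw [this, measureReal_empty]
      positivity
  have h3 : μ.real (⋃ A ∈ Finset.univ, S3 A) ≤ 1 / n := by
    refine (measureReal_biUnion_finset_le _ _).trans ?_
    have hle : ∀ A ∈ (Finset.univ : Finset (Finset (Fin n) × Finset (Fin n))),
        μ.real (S3 A) ≤ Real.exp (-3 * n) := by
      intro A _
      by_cases hc : Disjoint A.1 A.2 ∧ δ * n ≤ A.1.card ∧ δ * n ≤ A.2.card
      · refine (measureReal_mono fun G hG => ?_).trans (prob_large_le p hδ hp' hc.1 hc.2.1 hc.2.2)
        exact hG.2
      · have : S3 A = ∅ := Set.eq_empty_of_forall_notMem fun G hG => hc hG.1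
        rw [this, measureReal_empty]
        positivity
    refine (Finset.sum_le_sum hle).trans ?_
    rw [Finset.sum_const, Finset.card_univ, nsmul_eq_mul]
    have hcard : ((Fintype.card (Finset (Fin n) × Finset (Fin n)) : ℕ) : ℝ) ≤ Real.exp (2 * n) := by
      rw [Fintype.card_prod, Fintype.card_finset, Fintype.card_fin]
      push_cast
      rw [mul_comm (2 : ℝ), Real.exp_nat_mul, ← mul_pow]
      gcongr
      have := Real.add_one_le_exp (1 : ℝ)
      have h : Real.exp 2 = Real.exp 1 * Real.exp 1 := by rw [← Real.exp_add]; norm_num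
      rw [h]
      nlinarith
    calc _ ≤ Real.exp (2 * n) * Real.exp (-3 * n) := by gcongr
      _ = (Real.exp n)⁻¹ := by rw [← Real.exp_add, ← Real.exp_neg]; congr 1; ring
      _ ≤ 1 / n := by
          rw [one_div]
          have := Real.add_one_le_exp (n : ℝ)
          gcongr
          linarith
  calc _ ≤ μ.real _ := measureReal_mono hsub
    _ ≤ _ := measureReal_union_le _ _
    _ ≤ 2 / n + 2 / n + 1 / n := add_le_add ((measureReal_union_le _ _).trans (add_le_add h1 h2)) h3
    _ = _ := by ring

end

lemma Whp.mono {ε : ℝ} {A B : ∀ n : ℕ, [NeZero n] → SimpleGraph (Fin n) → Prop} (h : Whp ε A)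
    (N₀ : ℕ) (hAB : ∀ (n : ℕ) [NeZero n] (G : SimpleGraph (Fin n)), N₀ ≤ n → A n G → B n G) :
    Whp ε B := by
  intro τ hτ
  obtain ⟨N, hN⟩ := h τ hτ
  refine ⟨max N N₀, fun n _ hn p hp => ?_⟩
  refine (hN n ((le_max_left _ _).trans hn) p hp).trans (measureReal_mono fun G hG => ?_)
  exact hAB n G ((le_max_right _ _).trans hn) hG

/-- The exponent `1 + ε` enters here because the constants in `prob_not_isTypical_le` depend on `θ` and
`δ`: the factor `(log n) ^ ε` exceeds them eventually. -/
lemma whp_isTypical {ε θ δ : ℝ} (hε : 0 < ε) (hθ0 : 0 < θ) (hθ : θ ≤ 1) (hδ : 0 < δ) :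
    Whp ε fun _ _ G => IsTypical G θ δ := by
  intro τ hτ
  have hlim : Filter.Tendsto (fun n : ℕ => Real.log n) Filter.atTop Filter.atTop :=
    Real.tendsto_log_atTop.comp tendsto_natCast_atTop_atTop
  have hlim' : Filter.Tendsto (fun n : ℕ => Real.log n ^ ε) Filter.atTop Filter.atTop :=
    (tendsto_rpow_atTop hε).comp hlim
  have hev : ∀ᶠ n : ℕ in Filter.atTop, 64 / θ ^ 2 + 48 / δ ^ 2 ≤ Real.log n ^ ε ∧
      1 ≤ Real.log n ∧ 2 / θ + 5 / τ ≤ n ∧ 3 ≤ n :=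
    (hlim'.eventually_ge_atTop _).and ((hlim.eventually_ge_atTop _).and
      ((tendsto_natCast_atTop_atTop.eventually_ge_atTop _).and (Filter.eventually_ge_atTop _)))
  obtain ⟨N, hN⟩ := Filter.eventually_atTop.1 hev
  refine ⟨N, fun n _ hn p hp => ?_⟩
  obtain ⟨h1, h2, h3, h4⟩ := hN n hn
  have ha : 0 < 64 / θ ^ 2 := by positivity
  have hb : 0 < 48 / δ ^ 2 := by positivity
  have hc : 0 < 2 / θ := by positivity
  have he : 0 < 5 / τ := by positivity
  rw [Real.rpow_add (by linarith), Real.rpow_one] at hp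
  have hbad := prob_not_isTypical_le (n := n) p hθ0 hθ hδ (by linarith) h4 (by nlinarith)
    (by nlinarith)
  have hτn : 5 / (n : ℝ) ≤ τ := by
    have : (0 : ℝ) < n := by exact_mod_cast (by omega : 0 < n)
    rw [div_le_iff₀ this, ← div_le_iff₀' hτ]
    linarith
  have hone : 1 ≤ (SimpleGraph.binomialRandom (Fin n) p).real {G | IsTypical G θ δ} +
      (SimpleGraph.binomialRandom (Fin n) p).real {G | ¬ IsTypical G θ δ} := by
    refine le_trans ?_ (measureReal_union_le _ _)
    rw [← Set.ofPred_or]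
    simp [em]
  linarith

end

/-! ### Voting on random graphs -/

/-- With high probability, all winning probabilities are given by the interpolation `tent` at the
average opinion, up to a small additive error. -/
lemma whp_abs_winProb_sub_tent_le (s : Scheme) (k : ℕ) {ε : ℝ} (hε : 0 < ε) {η : ℝ} (hη : 0 < η) :
    Whp ε fun n _ G => ∀ X₀ : Fin n → ℤ, (∀ v, 1 ≤ X₀ v ∧ X₀ v ≤ k) → ∀ i : ℤ,
      |winProb s G X₀ i - tent i (average X₀)| ≤ η := by
  -- The constants make each of the three error terms at most `η / 4`.
  set L : ℝ := 64 * (k + 1) / η ^ 2 with hL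
  have hL0 : 0 < L := by positivity
  set θ : ℝ := min (1 / 4) (η / (16 * (k + 1))) with hθ
  have hθ0 : 0 < θ := lt_min (by norm_num) (by positivity)
  have hθ4 : θ ≤ 1 / 4 := min_le_left _ _
  set δ : ℝ := min (1 / 2) ((1 / (512 * L)) ^ 2 / 2) with hδ
  have hδ0 : 0 < δ := lt_min (by norm_num) (by positivity)
  have hδ2 : δ ≤ 1 / 2 := min_le_left _ _
  have hL1 : L ≤ 1 / (512 * √(2 * δ)) := by
    have h1 : 2 * δ ≤ (1 / (512 * L)) ^ 2 := by
      have := min_le_right (1 / 2) ((1 / (512 * L)) ^ 2 / 2)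
      linarith
    have h2 : √(2 * δ) ≤ 1 / (512 * L) := Real.sqrt_le_iff.2 ⟨by positivity, h1⟩
    have h3 : 0 < √(2 * δ) := Real.sqrt_pos.2 (by positivity)
    rw [le_div_iff₀ (by positivity)] at h2 ⊢
    linarith
  refine (whp_isTypical hε hθ0 (by linarith) hδ0).mono ⌈32 * L / δ ^ 2⌉₊ ?_
  intro n _ G hn hG X₀ hX₀ i
  have hX : X₀ ∈ box n 1 k := hX₀
  have hL2 : L ≤ δ ^ 2 * n / 32 := by
    have h1 : 32 * L / δ ^ 2 ≤ n := (Nat.le_ceil _).trans (by exact_mod_cast hn)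
    rw [div_le_iff₀ (by positivity)] at h1
    linarith
  have h1 := abs_winProb_sub_tent_le (hG.isBalanced hθ4 s) hδ2 (hG.isExpanding hθ4 s) hL0 hL1
    hL2 (τ := η / 4) (by positivity) (i := i) hX
  have h2 := hG.abs_weightedAverage_sub_le hθ0.le hθ4 s hX
  have h3 := abs_tent_sub_le i (weightedAverage (weight G s) X₀) (average X₀)
  have h4 : 4 * ((k : ℤ) + 1 : ℝ) / (L * (η / 4)) = η / 4 := by
    rw [hL]; push_cast; field_simp; norm_num
  have h5 : 4 * θ * (k : ℤ) ≤ η / 4 := by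
    have h6 : θ * (16 * (k + 1)) ≤ η := by
      rw [← le_div_iff₀ (by positivity)]; exact min_le_right _ _
    push_cast
    linarith
  have h6 := abs_sub_le (winProb s G X₀ i) (tent i (weightedAverage (weight G s) X₀))
    (tent i (average X₀))
  rw [h4] at h1
  linarith

lemma whp_expectedTime_le (s : Scheme) (k : ℕ) {ε : ℝ} (hε : 0 < ε) :
    Whp ε fun n _ G => ∀ X₀ : Fin n → ℤ, (∀ v, 1 ≤ X₀ v ∧ X₀ v ≤ k) →
      expectedTime s G X₀ ≤ (512 * (k + 1) : NNReal) * (n : ENNReal) ^ 2 := by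
  refine (whp_isTypical hε (θ := 1 / 4) (δ := 1 / 2) (by norm_num) (by norm_num)
    (by norm_num)).mono 0 ?_
  intro n _ G _ hG X₀ hX₀
  have hX : X₀ ∈ box n 1 k := hX₀
  refine (expectedTime_le_of_isExpanding (hG.isBalanced le_rfl s)
    (hG.isExpanding le_rfl s) hX).trans_eq ?_
  congr 1
  rw [← ENNReal.ofReal_coe_nnreal]
  push_cast
  rfl

lemma tent_of_mem_left {i : ℤ} {x : ℝ} (h1 : i ≤ x) (h2 : x ≤ i + 1) : tent i x = i + 1 - x := by
  rw [tent, abs_of_nonneg (by linarith), max_eq_right (by linarith)]; ring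

lemma tent_of_mem_right {i : ℤ} {x : ℝ} (h1 : i ≤ x) (h2 : x ≤ i + 1) :
    tent (i + 1) x = x - i := by
  push_cast [tent]
  rw [abs_of_nonpos (by linarith), max_eq_right (by linarith)]; ring

lemma average_le {n : ℕ} [NeZero n] {X : Fin n → ℤ} {lo hi : ℤ} (hX : X ∈ box n lo hi) :
    average X ≤ hi := by
  have hn : (0 : ℝ) < n := by exact_mod_cast Nat.pos_of_ne_zero (NeZero.ne n)
  rw [average, div_le_iff₀ hn, mul_comm]
  have := Finset.sum_le_card_nsmul Finset.univ (fun v => (X v : ℝ)) hi fun v _ => by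
    exact_mod_cast (hX v).2
  simpa using this

end IncrementalVoting

open IncrementalVoting in
theorem theorem2 (s : Scheme) (k : ℕ) (hk : 1 ≤ k) (ε : ℝ) (hε : 0 < ε) :
    -- if `i < c < i + 1`, then `ℙ(i wins) ∼ i + 1 - c` (with `i + 1 - c` bounded away from zero)
    (∀ η : ℝ, 0 < η → ∀ θ : ℝ, 0 < θ → Whp ε fun n _ G =>
      ∀ X₀ : Fin n → ℤ, (∀ v, 1 ≤ X₀ v ∧ X₀ v ≤ k) → ∀ i : ℤ,
        i < average X₀ → average X₀ < i + 1 → η ≤ i + 1 - average X₀ →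
          |winProb s G X₀ i - (i + 1 - average X₀)| ≤ θ * (i + 1 - average X₀)) ∧
    -- and `ℙ(i + 1 wins) ∼ c - i` (with `c - i` bounded away from zero)
    (∀ η : ℝ, 0 < η → ∀ θ : ℝ, 0 < θ → Whp ε fun n _ G =>
      ∀ X₀ : Fin n → ℤ, (∀ v, 1 ≤ X₀ v ∧ X₀ v ≤ k) → ∀ i : ℤ,
        i < average X₀ → average X₀ < i + 1 → η ≤ average X₀ - i →
          |winProb s G X₀ (i + 1) - (average X₀ - i)| ≤ θ * (average X₀ - i)) ∧
    -- if `c = i (1 + o(1))`, then `ℙ(i wins) ∼ 1`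
    (∀ θ : ℝ, 0 < θ → ∃ δ : ℝ, 0 < δ ∧ Whp ε fun n _ G =>
      ∀ X₀ : Fin n → ℤ, (∀ v, 1 ≤ X₀ v ∧ X₀ v ≤ k) → ∀ i : ℤ,
        |average X₀ - i| ≤ δ * i → |winProb s G X₀ i - 1| ≤ θ) ∧
    -- the expected time to finish is `O(n ^ 2)`
    (∃ C : NNReal, Whp ε fun n _ G =>
      ∀ X₀ : Fin n → ℤ, (∀ v, 1 ≤ X₀ v ∧ X₀ v ≤ k) →
        expectedTime s G X₀ ≤ C * (n : ENNReal) ^ 2) := by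
  refine ⟨fun η hη θ hθ => ?_, fun η hη θ hθ => ?_, fun θ hθ => ?_, ?_⟩
  · refine (whp_abs_winProb_sub_tent_le s k hε (mul_pos hθ hη)).mono 0 ?_
    intro n _ G _ h X₀ hX₀ i h1 h2 h3
    rw [← tent_of_mem_left h1.le h2.le] at h3 ⊢
    exact (h X₀ hX₀ i).trans (by gcongr)
  · refine (whp_abs_winProb_sub_tent_le s k hε (mul_pos hθ hη)).mono 0 ?_
    intro n _ G _ h X₀ hX₀ i h1 h2 h3
    rw [← tent_of_mem_right h1.le h2.le] at h3 ⊢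
    exact (h X₀ hX₀ (i + 1)).trans (by gcongr)
  · have hk' : (1 : ℝ) ≤ k := by exact_mod_cast hk
    refine ⟨min (1 / 2) (θ / (4 * k)), lt_min (by norm_num) (by positivity), ?_⟩
    refine (whp_abs_winProb_sub_tent_le s k hε (half_pos hθ)).mono 0 ?_
    intro n _ G _ h X₀ hX₀ i hi
    set δ := min (1 / 2) (θ / (4 * k)) with hδ
    have hδ2 : δ ≤ 1 / 2 := min_le_left _ _
    have hδ0 : 0 < δ := lt_min (by norm_num) (by positivity)
    have hδθ : δ * (4 * k) ≤ θ := by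
      rw [← le_div_iff₀ (by positivity)]; exact min_le_right _ _
    have hX : X₀ ∈ box n 1 k := hX₀
    have hc := average_le hX
    push_cast at hc
    -- `i` is at most `2 k`, so that the average is within `θ / 2` of `i`
    have hi0 : (0 : ℝ) ≤ i := nonneg_of_mul_nonneg_right ((abs_nonneg _).trans hi) hδ0
    have hi2 : (i : ℝ) ≤ 2 * k := by
      have := (abs_le.1 hi).1
      nlinarith
    have hclose : |average X₀ - i| ≤ θ / 2 := by
      have : δ * i ≤ δ * (2 * k) := by gcongr
      linarith
    have h1 := h X₀ hX₀ i
    have h2 := abs_tent_sub_le i (average X₀) i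
    rw [tent_intCast, if_pos rfl] at h2
    have h3 := abs_sub_le (winProb s G X₀ i) (tent i (average X₀)) 1
    linarith
  · exact ⟨_, whp_expectedTime_le s k hε⟩
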